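/- Let $G=(U\cup V,E)$ be a finite bipartite graph with $U\neq\emptyset$. For $0\le k\le |V|$, $G$ is called $k$-CM if for every $V'\subseteq V$ with $|V'|=|V|-k$ the induced subgraph $G[U\cup V']$ has a matching that covers all vertices of $U$; $\kappa(G)$ is the maximum $k$ such that $G$ is $k$-CM (it exists if and only if $G$ has a matching covering $U$). For $u_0\in U$ let $(IP_{u_0})$ be the integer program $$\min \sum_{v\in V}x_v-\sum_{u\in U}x_u\quad\text{s.t.}\quad x_{u_0}=1,\quad x_u-x_v\le 0\ (uv\in E,\ u\in U,\ v\in V),\quad x_w\le 1,\ -x_w\le 0\ (w\in U\cup V),\quad x_w\in\{0,1\}.$$ Then: 1. For every $u_0\in U$ the constraint matrix of $(IP_{u_0})$ is totally unimodular, the linear relaxation of $(IP_{u_0})$ is integral (every extreme point of its feasible polytope is a $0/1$ vector), and $(IP_{u_0})$ and its linear relaxation both attain their minimum, with the same integer value. 2. Let $z(G)$ be the minimum over $u_0\in U$ of the optimal values of the programs $(IP_{u_0})$. If $G$ has a matching covering $U$, then $z(G)=\kappa(G)\geq 0$; otherwise $z(G)<0$. 3. The Bipartite Complete Matching Blocker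 Problem can be solved in polynomial time: there are a single program for a random access machine (registers and arrays of natural numbers; assignment, addition, truncated subtraction, indirect reading and writing, conditionals and while-loops, each elementary operation and each test counting as one step) and a polynomial $p$ such that, on every bipartite graph $G$ with $|U|\ge 1$, given by $|U|$, $|V|$ and its bipartite adjacency matrix, the program halts after at most $p(|U|+|V|)$ steps with output $z(G)$; hence it outputs $\kappa(G)$ if $G$ has a matching covering $U$, and a negative integer otherwise. -/

import Mathlib

namespace BCMBP

/-! ### Complete matchings and the blocker value

A bipartite graph with parts `U` and `V` is a `SimpleGraph (U ⊕ V)` all of whose edges join the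
two summands. -/

/-- Every edge joins `U` and `V`. -/
def Bipartite {U V : Type*} (G : SimpleGraph (U ⊕ V)) : Prop :=
  G.IsBipartiteWith (Set.range Sum.inl) (Set.range Sum.inr)

/-- The induced subgraph `G[U ∪ V']` has a matching that covers every vertex of `U`. -/
def HasCompleteMatching {U V : Type*} (G : SimpleGraph (U ⊕ V)) (V' : Finset V) : Prop :=
  ∃ M : G.Subgraph,
    M ≤ (⊤ : G.Subgraph).induce (Set.range Sum.inl ∪ Sum.inr '' (V' : Set V)) ∧
    M.IsMatching ∧ Set.range Sum.inl ⊆ M.verts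

/-- `G` is `k`-CM: after removal of any `k` vertices of `V` there is a complete matching on `U`.
(Only `0 ≤ k ≤ |V|` makes sense.) -/
def IsKCM {U V : Type*} [Fintype V] (G : SimpleGraph (U ⊕ V)) (k : ℕ) : Prop :=
  k ≤ Fintype.card V ∧
    ∀ V' : Finset V, V'.card = Fintype.card V - k → HasCompleteMatching G V'

/-- `κ` is the maximum number `k` such that `G` is `k`-CM. -/
def IsKappa {U V : Type*} [Fintype V] (G : SimpleGraph (U ⊕ V)) (κ : ℕ) : Prop :=
  IsGreatest {k : ℕ | IsKCM G k} κ

/-! ### The integer program attached to a vertex `u₀ ∈ U` -/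

/-- Indices of the constraints: `x_{u₀} = 1`, then one inequality for each edge `uv`, then the
upper bounds `x_w ≤ 1`, then the lower bounds `-x_w ≤ 0`. -/
abbrev Row {U V : Type*} (G : SimpleGraph (U ⊕ V)) : Type _ :=
  Unit ⊕ ({e : U × V // G.Adj (Sum.inl e.1) (Sum.inr e.2)} ⊕ ((U ⊕ V) ⊕ (U ⊕ V)))

/-- The constraint matrix. -/
def ipMatrix {U V : Type*} [DecidableEq U] [DecidableEq V] (G : SimpleGraph (U ⊕ V)) (u₀ : U) :
    Matrix (Row G) (U ⊕ V) ℤ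
  | Sum.inl _ => Pi.single (Sum.inl u₀) 1
  | Sum.inr (Sum.inl e) => Pi.single (Sum.inl e.1.1) 1 - Pi.single (Sum.inr e.1.2) 1
  | Sum.inr (Sum.inr (Sum.inl w)) => Pi.single w 1
  | Sum.inr (Sum.inr (Sum.inr w)) => -Pi.single w 1

/-- The right-hand side. -/
def ipRhs {U V : Type*} (G : SimpleGraph (U ⊕ V)) : Row G → ℤ
  | Sum.inl _ => 1
  | Sum.inr (Sum.inl _) => 0
  | Sum.inr (Sum.inr (Sum.inl _)) => 1
  | Sum.inr (Sum.inr (Sum.inr _)) => 0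

/-- Feasible points of the linear relaxation: the first row is an equation, all other rows are
inequalities `≤`. -/
def lpFeasible {U V : Type*} [Fintype U] [Fintype V] [DecidableEq U] [DecidableEq V]
    (G : SimpleGraph (U ⊕ V)) (u₀ : U) : Set (U ⊕ V → ℝ) :=
  {x | ((ipMatrix G u₀).map (Int.cast : ℤ → ℝ)).mulVec x (Sum.inl ()) = ipRhs G (Sum.inl ()) ∧
    ∀ r, ((ipMatrix G u₀).map (Int.cast : ℤ → ℝ)).mulVec x (Sum.inr r) ≤ ipRhs G (Sum.inr r)}

/-- Feasible points of the integer program: in addition every variable is `0` or `1`. -/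
def ipFeasible {U V : Type*} [Fintype U] [Fintype V] [DecidableEq U] [DecidableEq V]
    (G : SimpleGraph (U ⊕ V)) (u₀ : U) : Set (U ⊕ V → ℝ) :=
  {x | x ∈ lpFeasible G u₀ ∧ ∀ w, x w = 0 ∨ x w = 1}

/-- The objective function, to be minimized. -/
def objective {U V : Type*} [Fintype U] [Fintype V] (x : U ⊕ V → ℝ) : ℝ :=
  ∑ v : V, x (Sum.inr v) - ∑ u : U, x (Sum.inl u)

/-- `z` is the optimal value of the integer program of `u₀`. -/
def IsIPValue {U V : Type*} [Fintype U] [Fintype V] [DecidableEq U] [DecidableEq V]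
    (G : SimpleGraph (U ⊕ V)) (u₀ : U) (z : ℤ) : Prop :=
  IsLeast (objective '' ipFeasible G u₀) (z : ℝ)

/-- `z` is the optimal value of the linear relaxation of the integer program of `u₀`. -/
def IsLPValue {U V : Type*} [Fintype U] [Fintype V] [DecidableEq U] [DecidableEq V]
    (G : SimpleGraph (U ⊕ V)) (u₀ : U) (z : ℤ) : Prop :=
  IsLeast (objective '' lpFeasible G u₀) (z : ℝ)

/-! ### A random access machine with a step count

A machine has registers and arrays of natural numbers, and a program mentions finitely many of
them. The only arithmetic operations are addition and truncated subtraction, each at unit cost, so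
`t` steps lengthen the numbers in the store by at most `t` bits: this is the usual unit-cost random
access machine without multiplication, polynomially equivalent to Turing machines. -/

/-- Contents of the registers, `reg i`, and of the arrays, `arr a p`. -/
structure Store where
  reg : ℕ → ℕ
  arr : ℕ → ℕ → ℕ

/-- Assignment to a register. -/
def Store.setReg (s : Store) (i c : ℕ) : Store :=
  { s with reg := Function.update s.reg i c }

/-- Assignment to an array cell. -/
def Store.setArr (s : Store) (a p c : ℕ) : Store :=
  { s with arr := Function.update s.arr a (Function.update (s.arr a) p c) }

/-- Programs. -/
inductive Prog where
  /-- do nothing -/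
  | skip : Prog
  /-- `reg i := c` -/
  | const (i c : ℕ) : Prog
  /-- `reg i := reg j` -/
  | copy (i j : ℕ) : Prog
  /-- `reg i := reg j + reg k` -/
  | add (i j k : ℕ) : Prog
  /-- `reg i := reg j - reg k`, truncated at `0` -/
  | sub (i j k : ℕ) : Prog
  /-- `reg i := arr a (reg j)` -/
  | load (i a j : ℕ) : Prog
  /-- `arr a (reg i) := reg j` -/
  | store (a i j : ℕ) : Prog
  /-- first `P`, then `Q` -/
  | seq (P Q : Prog) : Prog
  /-- if `reg i ≠ 0` then `P` else `Q` -/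
  | ite (i : ℕ) (P Q : Prog) : Prog
  /-- while `reg i ≠ 0` do `P` -/
  | loop (i : ℕ) (P : Prog) : Prog

/-- `Runs P s t s'`: the program `P`, started in `s`, halts in `s'` after exactly `t` steps, where
every elementary instruction and every test counts as one step. -/
inductive Runs : Prog → Store → ℕ → Store → Prop where
  | skip (s : Store) : Runs .skip s 1 s
  | const (s : Store) (i c : ℕ) : Runs (.const i c) s 1 (s.setReg i c)
  | copy (s : Store) (i j : ℕ) : Runs (.copy i j) s 1 (s.setReg i (s.reg j))
  | add (s : Store) (i j k : ℕ) : Runs (.add i j k) s 1 (s.setReg i (s.reg j + s.reg k))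
  | sub (s : Store) (i j k : ℕ) : Runs (.sub i j k) s 1 (s.setReg i (s.reg j - s.reg k))
  | load (s : Store) (i a j : ℕ) : Runs (.load i a j) s 1 (s.setReg i (s.arr a (s.reg j)))
  | store (s : Store) (a i j : ℕ) : Runs (.store a i j) s 1 (s.setArr a (s.reg i) (s.reg j))
  | seq {P Q : Prog} {s s' s'' : Store} {t t' : ℕ} :
      Runs P s t s' → Runs Q s' t' s'' → Runs (.seq P Q) s (t + t') s''
  | ite_true {i : ℕ} {P Q : Prog} {s s' : Store} {t : ℕ} :
      s.reg i ≠ 0 → Runs P s t s' → Runs (.ite i P Q) s (t + 1) s'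
  | ite_false {i : ℕ} {P Q : Prog} {s s' : Store} {t : ℕ} :
      s.reg i = 0 → Runs Q s t s' → Runs (.ite i P Q) s (t + 1) s'
  | loop_done {i : ℕ} {P : Prog} {s : Store} :
      s.reg i = 0 → Runs (.loop i P) s 1 s
  | loop_step {i : ℕ} {P : Prog} {s s' s'' : Store} {t t' : ℕ} :
      s.reg i ≠ 0 → Runs P s t s' → Runs (.loop i P) s' t' s'' →
      Runs (.loop i P) s (t + t' + 1) s''

open Classical in
/-- The input: `reg 0 = |U|`, `reg 1 = |V|`, and array `0` holds the bipartite adjacency matrix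
row by row; everything else is `0`. -/
noncomputable def input {m n : ℕ} (G : SimpleGraph (Fin m ⊕ Fin n)) : Store where
  reg := fun i => if i = 0 then m else if i = 1 then n else 0
  arr := fun a p =>
    if a = 0 ∧ ∃ (i : Fin m) (j : Fin n), p = i * n + j ∧ G.Adj (Sum.inl i) (Sum.inr j)
    then 1 else 0

/-- The integer `z` is written in the registers `0` (positive part) and `1` (negative part). -/
def Outputs (s : Store) (z : ℤ) : Prop :=
  s.reg 0 = z.toNat ∧ s.reg 1 = (-z).toNat

/-- `P` computes in polynomial time, from any bipartite graph with parts of sizes `m ≥ 1` and `n`,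
an integer that satisfies `spec`; the polynomial bounds the number of steps in terms of the number
of vertices. -/
def SolvesInPolyTime (P : Prog)
    (spec : ∀ m n : ℕ, SimpleGraph (Fin m ⊕ Fin n) → ℤ → Prop) : Prop :=
  ∃ p : Polynomial ℕ, ∀ (m n : ℕ) (G : SimpleGraph (Fin m ⊕ Fin n)), 1 ≤ m → Bipartite G →
    ∃ (t : ℕ) (s : Store) (z : ℤ), Runs P (input G) t s ∧ t ≤ p.eval (m + n) ∧
      Outputs s z ∧ spec m n G z

end BCMBP

namespace BCMBP

/-! Everything reduces to the surplus $|N(S)|-|S|$ of sets $S\subseteq U$. A 0/1 feasible point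
selects a set $S\ni u_0$ and a superset of $N(S)$, so the program of $u_0$ minimizes the surplus
over $S\ni u_0$ (`isIPValue_iff`), and $z(G)$ is the minimum over nonempty $S$
(`isLeast_isIPValue_iff`). By Hall's theorem $G$ is $k$-CM exactly when every nonempty $S$ has
surplus at least $k$ (`isKCM_iff`). Hence $\kappa(G)=z(G)$ if $z(G)\ge 0$, and otherwise no $k$
qualifies (`isKappa_iff`).

Each constraint row has at most one $1$ and one $-1$, which gives total unimodularity. Integrality
is proved directly: the constraints other than $x_{u_0}=1$ only compare coordinates with each other
and with $0$ and $1$, so they survive increasing maps of $[0,1]$ fixing the end points, and $x$ is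
the midpoint of $x^2$ and $2x-x^2$.

For the algorithm, fix $u_0$ and price its neighbours out of an auction. At the end let $D$ be the
set of vertices that gave up. All others own distinct vertices outside $N(u_0)$, so $|N(u_0)|-|D|$
is a lower bound for the surplus of every $S\ni u_0$. There are more price levels than vertices of
$V$, so some level is free; cutting the prices there yields a set that attains the bound
(`AuctionInv.isLeast_surplus`). Each bid raises a bounded price, so the number of bids is
polynomial. The rest verifies a program that runs this auction for every $u_0$. -/

/-! ### Total unimodularity -/

/-- The entries are `0`, `1`, `-1`, and each of `1` and `-1` occurs at most once. -/
def IsArcRow {α : Type*} (r : α → ℤ) : Prop :=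
  (∀ j, r j = 0 ∨ r j = 1 ∨ r j = -1) ∧
    (∀ j k, r j = 1 → r k = 1 → j = k) ∧ (∀ j k, r j = -1 → r k = -1 → j = k)

lemma IsArcRow.comp {α β : Type*} {r : α → ℤ} (h : IsArcRow r) {f : β → α}
    (hf : f.Injective) : IsArcRow (r ∘ f) :=
  ⟨fun j => h.1 (f j), fun _ _ hj hk => hf (h.2.1 _ _ hj hk),
    fun _ _ hj hk => hf (h.2.2 _ _ hj hk)⟩

lemma IsArcRow.sum_eq_zero {α : Type*} [Fintype α] {r : α → ℤ}
    (h : IsArcRow r) {j k : α} (hj : r j = 1) (hk : r k = -1) : ∑ i, r i = 0 := by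
  classical
  have hjk : j ≠ k := by rintro rfl; omega
  rw [Fintype.sum_eq_add j k hjk, hj, hk]
  · norm_num
  · rintro x ⟨hxj, hxk⟩
    rcases h.1 x with h0 | h1 | h1
    · exact h0
    · exact absurd (h.2.1 _ _ h1 hj) hxj
    · exact absurd (h.2.2 _ _ h1 hk) hxk

lemma IsArcRow.exists_unique_support {α : Type*} [Nonempty α] {r : α → ℤ} (h : IsArcRow r)
    (hr : ¬ ((∃ j, r j = 1) ∧ ∃ k, r k = -1)) : ∃ j, ∀ k, k ≠ j → r k = 0 := by
  by_cases h1 : ∃ j, r j = 1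
  · obtain ⟨j, hj⟩ := h1
    refine ⟨j, fun k hk => ?_⟩
    rcases h.1 k with h0 | h2 | h2
    · exact h0
    · exact absurd (h.2.1 _ _ h2 hj) hk
    · exact absurd ⟨⟨j, hj⟩, k, h2⟩ hr
  · by_cases h2 : ∃ j, r j = -1
    · obtain ⟨j, hj⟩ := h2
      refine ⟨j, fun k hk => ?_⟩
      rcases h.1 k with h0 | h3 | h3
      · exact h0
      · exact absurd ⟨k, h3⟩ h1
      · exact absurd (h.2.2 _ _ h3 hj) hk
    · refine ⟨Classical.arbitrary α, fun k _ => ?_⟩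
      rcases h.1 k with h0 | h3 | h3
      · exact h0
      · exact absurd ⟨k, h3⟩ h1
      · exact absurd ⟨k, h3⟩ h2

/-- If every row contains both a $1$ and a $-1$, all row sums vanish and the matrix is singular.
Otherwise some row has at most one nonzero entry, and expansion along it reduces to a smaller matrix
of the same kind. -/
lemma det_of_isArcRow : ∀ (k : ℕ) (A : Matrix (Fin k) (Fin k) ℤ), (∀ i, IsArcRow (A i)) →
    A.det = 0 ∨ A.det = 1 ∨ A.det = -1
  | 0, A, _ => by simp
  | k + 1, A, hA => by
    by_cases hall : ∀ i, (∃ j, A i j = 1) ∧ ∃ j, A i j = -1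
    · left
      refine Matrix.exists_mulVec_eq_zero_iff.mp ⟨fun _ => 1, ?_, ?_⟩
      · exact fun h => one_ne_zero (congrFun h 0)
      · funext i
        obtain ⟨⟨j, hj⟩, l, hl⟩ := hall i
        simpa [Matrix.mulVec, dotProduct] using (hA i).sum_eq_zero hj hl
    · push Not at hall
      obtain ⟨i, hi⟩ := hall
      obtain ⟨j, hj⟩ := (hA i).exists_unique_support (fun h => by
        obtain ⟨h1, l, hl⟩ := h
        exact hi h1 l hl)
      have hsub := det_of_isArcRow k (A.submatrix i.succAbove j.succAbove)
        (fun l => (hA (i.succAbove l)).comp Fin.succAbove_right_injective)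
      rw [Matrix.det_succ_row A i, Finset.sum_eq_single j
        (fun b _ hb => by rw [hj b hb]; ring) (by simp)]
      rcases neg_one_pow_eq_or ℤ ((i : ℕ) + (j : ℕ)) with h1 | h1 <;>
      rcases (hA i).1 j with h2 | h2 | h2 <;>
      rcases hsub with h3 | h3 | h3 <;> rw [h1, h2, h3] <;> norm_num

theorem isTotallyUnimodular_of_isArcRow {m n : Type*} (A : Matrix m n ℤ)
    (hA : ∀ i, IsArcRow (A i)) : A.IsTotallyUnimodular := by
  intro k f g _ hg
  rcases det_of_isArcRow k (A.submatrix f g) (fun i => (hA (f i)).comp hg) with h | h | h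
  · exact ⟨0, by simp [h]⟩
  · exact ⟨1, by simp [h]⟩
  · exact ⟨-1, by simp [h]⟩

lemma isArcRow_single {α : Type*} [DecidableEq α] (a : α) :
    IsArcRow (Pi.single a 1 : α → ℤ) := by
  refine ⟨fun j => ?_, fun j k hj hk => ?_, fun j k hj hk => ?_⟩ <;>
  simp only [Pi.single_apply] at * <;> grind

lemma isArcRow_neg_single {α : Type*} [DecidableEq α] (a : α) :
    IsArcRow (-Pi.single a 1 : α → ℤ) := by
  refine ⟨fun j => ?_, fun j k hj hk => ?_, fun j k hj hk => ?_⟩ <;>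
  simp only [Pi.single_apply, Pi.neg_apply] at * <;> grind

lemma isArcRow_single_sub_single {α : Type*} [DecidableEq α] (a b : α) :
    IsArcRow (Pi.single a 1 - Pi.single b 1 : α → ℤ) := by
  refine ⟨fun j => ?_, fun j k hj hk => ?_, fun j k hj hk => ?_⟩ <;>
  simp only [Pi.single_apply, Pi.sub_apply] at * <;> grind

/-- The negative of the objective, as a continuous linear functional. -/
noncomputable def negObjective {U V : Type*} [Fintype U] [Fintype V] : StrongDual ℝ (U ⊕ V → ℝ) :=
  ∑ u : U, ContinuousLinearMap.proj (Sum.inl u) - ∑ v : V, ContinuousLinearMap.proj (Sum.inr v)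

lemma negObjective_apply {U V : Type*} [Fintype U] [Fintype V] (x : U ⊕ V → ℝ) : negObjective x = -objective x := by
  simp [negObjective, objective]

section LinearProgram

variable {U V : Type*} [DecidableEq U] [DecidableEq V]

theorem ipMatrix_isTotallyUnimodular (G : SimpleGraph (U ⊕ V)) (u : U) :
    (ipMatrix G u).IsTotallyUnimodular := by
  refine isTotallyUnimodular_of_isArcRow _ ?_
  rintro (_ | e | w | w)
  · exact isArcRow_single _
  · exact isArcRow_single_sub_single _ _
  · exact isArcRow_single _
  · exact isArcRow_neg_single _

variable [Fintype U] [Fintype V]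

/-! ### The linear relaxation -/

lemma ipMatrix_mulVec (G : SimpleGraph (U ⊕ V)) (u : U) (x : U ⊕ V → ℝ) :
    (∀ r, ((ipMatrix G u).map (Int.cast : ℤ → ℝ)).mulVec x (Sum.inl r) = x (Sum.inl u)) ∧
    (∀ e, ((ipMatrix G u).map (Int.cast : ℤ → ℝ)).mulVec x (Sum.inr (Sum.inl e)) =
      x (Sum.inl e.1.1) - x (Sum.inr e.1.2)) ∧
    (∀ w, ((ipMatrix G u).map (Int.cast : ℤ → ℝ)).mulVec x (Sum.inr (Sum.inr (Sum.inl w))) =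
      x w) ∧
    (∀ w, ((ipMatrix G u).map (Int.cast : ℤ → ℝ)).mulVec x (Sum.inr (Sum.inr (Sum.inr w))) =
      -x w) := by
  have hs : ∀ w : U ⊕ V, ∑ j, ((Pi.single w (1 : ℤ) : U ⊕ V → ℤ) j : ℝ) * x j = x w := by
    intro w
    rw [Finset.sum_eq_single w]
    · simp
    · intro b _ hb; simp [hb]
    · simp
  refine ⟨fun _ => hs _, fun e => ?_, fun w => hs w, fun w => ?_⟩
  · rw [← hs (Sum.inl e.1.1), ← hs (Sum.inr e.1.2), ← Finset.sum_sub_distrib]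
    refine Finset.sum_congr rfl fun j _ => ?_
    simp only [Matrix.map_apply, ipMatrix, Pi.sub_apply, Int.cast_sub]
    ring
  · rw [← hs w, ← Finset.sum_neg_distrib]
    refine Finset.sum_congr rfl fun j _ => ?_
    simp only [Matrix.map_apply, ipMatrix, Pi.neg_apply, Int.cast_neg]
    ring

lemma mem_lpFeasible {G : SimpleGraph (U ⊕ V)} {u : U} {x : U ⊕ V → ℝ} :
    x ∈ lpFeasible G u ↔ x (Sum.inl u) = 1 ∧
      (∀ a b, G.Adj (Sum.inl a) (Sum.inr b) → x (Sum.inl a) ≤ x (Sum.inr b)) ∧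
      ∀ w, 0 ≤ x w ∧ x w ≤ 1 := by
  obtain ⟨h1, h2, h3, h4⟩ := ipMatrix_mulVec G u x
  simp only [lpFeasible, Set.mem_ofPred_eq, Sum.forall, h1, h2, h3, h4]
  simp only [ipRhs]
  constructor
  · rintro ⟨ha, hb, hc, hd⟩
    refine ⟨by simpa using ha, fun a b hab => by simpa using hb ⟨(a, b), hab⟩,
      fun a => ⟨by simpa using hd.1 a, by simpa using hc.1 a⟩,
      fun a => ⟨by simpa using hd.2 a, by simpa using hc.2 a⟩⟩
  · rintro ⟨ha, hb, hc, hd⟩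
    refine ⟨by simpa using ha, fun e => by simpa using hb _ _ e.2,
      ⟨fun a => by simpa using (hc a).2, fun a => by simpa using (hd a).2⟩,
      fun a => by simpa using (hc a).1, fun a => by simpa using (hd a).1⟩

/-- An increasing map of the unit interval that fixes the end points preserves feasibility. -/
lemma lpFeasible.map {G : SimpleGraph (U ⊕ V)} {u : U} {x : U ⊕ V → ℝ}
    (hx : x ∈ lpFeasible G u) {φ : ℝ → ℝ} (h0 : φ 0 = 0) (h1 : φ 1 = 1)
    (hφ : ∀ s t, 0 ≤ s → s ≤ t → t ≤ 1 → φ s ≤ φ t) : (fun w => φ (x w)) ∈ lpFeasible G u := by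
  rw [mem_lpFeasible] at hx ⊢
  obtain ⟨ha, hb, hc⟩ := hx
  refine ⟨by simp [ha, h1], fun a b hab => hφ _ _ (hc _).1 (hb a b hab) (hc _).2, fun w => ?_⟩
  exact ⟨by simpa [h0] using hφ 0 (x w) le_rfl (hc w).1 (hc w).2,
    by simpa [h1] using hφ (x w) 1 (hc w).1 (hc w).2 le_rfl⟩

theorem eq_zero_or_one_of_mem_extremePoints {G : SimpleGraph (U ⊕ V)} {u : U} {x : U ⊕ V → ℝ}
    (hx : x ∈ (lpFeasible G u).extremePoints ℝ) (w : U ⊕ V) : x w = 0 ∨ x w = 1 := by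
  rw [mem_extremePoints] at hx
  obtain ⟨hmem, hext⟩ := hx
  -- Both $s\mapsto s^2$ and $s\mapsto 2s-s^2$ increase on $[0,1]$ and fix $0$ and $1$; their
  -- average is the identity. Extremality therefore forces $x_w^2=x_w$.
  have h1 := lpFeasible.map hmem (φ := fun s => s ^ 2) (by norm_num) (by norm_num)
    (fun s t hs hst ht => by nlinarith)
  have h2 := lpFeasible.map hmem (φ := fun s => 2 * s - s ^ 2) (by norm_num) (by norm_num)
    (fun s t hs hst ht => by nlinarith)
  have h3 := (hext _ h1 _ h2 ⟨1 / 2, 1 / 2, by norm_num, by norm_num, by norm_num, by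
    funext v
    simp only [Pi.add_apply, Pi.smul_apply, smul_eq_mul]
    ring⟩).1
  have h4 : x w ^ 2 = x w := congrFun h3 w
  have h5 : x w * (x w - 1) = 0 := by linarith
  rcases mul_eq_zero.mp h5 with h | h
  · exact Or.inl h
  · exact Or.inr (by linarith)

lemma isCompact_lpFeasible (G : SimpleGraph (U ⊕ V)) (u : U) : IsCompact (lpFeasible G u) := by
  have hset : lpFeasible G u = {x | x (Sum.inl u) = 1} ∩
      ((⋂ a, ⋂ b, ⋂ (_ : G.Adj (Sum.inl a) (Sum.inr b)),
        {x : U ⊕ V → ℝ | x (Sum.inl a) ≤ x (Sum.inr b)}) ∩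
      Set.pi Set.univ fun _ => Set.Icc 0 1) := by
    ext x
    simp only [mem_lpFeasible, Set.mem_inter_iff, Set.mem_iInter, Set.mem_ofPred_eq, Set.mem_pi,
      Set.mem_univ, forall_const, Set.mem_Icc]
  rw [hset, ← Set.inter_assoc]
  refine IsCompact.inter_left (isCompact_univ_pi fun _ => isCompact_Icc) (IsClosed.inter ?_ ?_)
  · exact isClosed_eq (continuous_apply _) continuous_const
  · exact isClosed_iInter fun a => isClosed_iInter fun b => isClosed_iInter fun _ =>
      isClosed_le (continuous_apply _) (continuous_apply _)

/-- The relaxation attains its minimum at a feasible point of the integer program. -/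
theorem exists_ipFeasible_forall_lpFeasible_le (G : SimpleGraph (U ⊕ V)) (u : U) :
    ∃ x ∈ ipFeasible G u, ∀ y ∈ lpFeasible G u, objective x ≤ objective y := by
  have hne : (lpFeasible G u).Nonempty :=
    ⟨fun _ => 1, mem_lpFeasible.mpr ⟨rfl, fun _ _ _ => le_rfl, fun _ => by norm_num⟩⟩
  -- The minimizers form a compact exposed face; an extreme point of that face is extreme in the
  -- whole polytope, hence a 0/1 vector.
  have hexp := ContinuousLinearMap.toExposed.isExposed (l := negObjective) (A := lpFeasible G u)
  obtain ⟨x₀, hx₀, hmax⟩ := (isCompact_lpFeasible G u).exists_isMaxOn hne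
    (negObjective (U := U) (V := V)).continuous.continuousOn
  have hface : (ContinuousLinearMap.toExposed negObjective (lpFeasible G u)).Nonempty := ⟨x₀, hx₀, hmax⟩
  obtain ⟨x, hx⟩ :=
    (hexp.isCompact (isCompact_lpFeasible G u)).extremePoints_nonempty hface
  have hx' := hexp.isExtreme.extremePoints_subset_extremePoints hx
  refine ⟨x, ⟨hx'.1, eq_zero_or_one_of_mem_extremePoints hx'⟩, fun y hy => ?_⟩
  have := hx.1.2 y hy
  rw [negObjective_apply, negObjective_apply] at this
  linarith

/-! ### The integer program in terms of neighbourhoods -/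

open Classical in
/-- The neighbourhood of a set of vertices. -/
noncomputable def nbr {U V : Type*} [Fintype V] (A : U → V → Prop) (S : Finset U) : Finset V :=
  {v | ∃ u ∈ S, A u v}

lemma mem_nbr {U V : Type*} [Fintype V] {A : U → V → Prop} {S : Finset U} {v : V} :
    v ∈ nbr A S ↔ ∃ u ∈ S, A u v := by
  simp [nbr]

/-- `|N(S)| - |S|`. -/
noncomputable def surplus {U V : Type*} [Fintype V] (A : U → V → Prop) (S : Finset U) : ℤ :=
  (nbr A S).card - S.card

/-- The bipartite adjacency relation. -/
def biadj {U V : Type*} (G : SimpleGraph (U ⊕ V)) (u : U) (v : V) : Prop :=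
  G.Adj (Sum.inl u) (Sum.inr v)

/-- The witness is the indicator of $S\cup N(S)$. -/
lemma exists_ipFeasible_objective_eq_surplus (G : SimpleGraph (U ⊕ V)) {u : U} {S : Finset U}
    (hu : u ∈ S) : ∃ x ∈ ipFeasible G u, objective x = surplus (biadj G) S := by
  classical
  refine ⟨Sum.elim (fun a => if a ∈ S then 1 else 0)
    (fun b => if b ∈ nbr (biadj G) S then 1 else 0), ⟨mem_lpFeasible.mpr ⟨by simp [hu], ?_, ?_⟩, ?_⟩,
    by simp [objective, surplus]⟩
  · intro a b hab
    by_cases ha : a ∈ S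
    · have hb : b ∈ nbr (biadj G) S := mem_nbr.mpr ⟨a, ha, hab⟩
      simp [ha, hb]
    · simp only [Sum.elim_inl, Sum.elim_inr, ha, if_false]
      split_ifs <;> norm_num
  · rintro (a | b) <;> simp only [Sum.elim_inl, Sum.elim_inr] <;> split_ifs <;> norm_num
  · rintro (a | b) <;> simp only [Sum.elim_inl, Sum.elim_inr] <;> split_ifs <;> norm_num

/-- With $S$ the set of $u$ where $x_u=1$, the edge constraints force $x_v=1$ on all of $N(S)$. -/
lemma exists_surplus_le_objective {G : SimpleGraph (U ⊕ V)} {u : U} {x : U ⊕ V → ℝ}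
    (hx : x ∈ ipFeasible G u) :
    ∃ S : Finset U, u ∈ S ∧ (surplus (biadj G) S : ℝ) ≤ objective x := by
  classical
  obtain ⟨hlp, h01⟩ := hx
  obtain ⟨hu, hadj, hb⟩ := mem_lpFeasible.mp hlp
  have h1 : ∑ a : U, x (Sum.inl a) = (Finset.card {a : U | x (Sum.inl a) = 1} : ℝ) := by
    rw [Finset.card_filter, Nat.cast_sum]
    refine Finset.sum_congr rfl fun a _ => ?_
    rcases h01 (Sum.inl a) with h | h <;> simp [h]
  have h2 : ((nbr (biadj G) {a | x (Sum.inl a) = 1}).card : ℝ) ≤ ∑ b : V, x (Sum.inr b) := by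
    rw [Finset.card_eq_sum_ones, Nat.cast_sum]
    refine le_trans (Finset.sum_le_sum (g := fun b => x (Sum.inr b)) fun b hb' => ?_)
      (Finset.sum_le_sum_of_subset_of_nonneg (Finset.subset_univ _) fun b _ _ => (hb _).1)
    obtain ⟨a, ha, hab⟩ := mem_nbr.mp hb'
    have := hadj a b hab
    simp only [Finset.mem_filter, Finset.mem_univ, true_and] at ha
    simpa [ha] using this
  refine ⟨({a | x (Sum.inl a) = 1} : Finset U), by simpa using hu, ?_⟩
  simp only [surplus, objective, Int.cast_sub, Int.cast_natCast]
  linarith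

lemma isIPValue_iff {G : SimpleGraph (U ⊕ V)} {u : U} {z : ℤ} :
    IsIPValue G u z ↔ IsLeast (surplus (biadj G) '' {S | u ∈ S}) z := by
  constructor
  · rintro ⟨⟨x, hx, hxz⟩, hle⟩
    have hle' : ∀ S : Finset U, u ∈ S → z ≤ surplus (biadj G) S := by
      intro S hS
      obtain ⟨y, hy, hyS⟩ := exists_ipFeasible_objective_eq_surplus G hS
      have := hle ⟨y, hy, rfl⟩
      rw [hyS] at this
      exact_mod_cast this
    obtain ⟨S, hS, hSx⟩ := exists_surplus_le_objective hx
    rw [hxz] at hSx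
    refine ⟨⟨S, hS, le_antisymm (by exact_mod_cast hSx) (hle' S hS)⟩, ?_⟩
    rintro _ ⟨T, hT, rfl⟩
    exact hle' T hT
  · rintro ⟨⟨S, hS, rfl⟩, hle⟩
    obtain ⟨y, hy, hyS⟩ := exists_ipFeasible_objective_eq_surplus G hS
    refine ⟨⟨y, hy, hyS⟩, ?_⟩
    rintro _ ⟨x, hx, rfl⟩
    obtain ⟨T, hT, hTx⟩ := exists_surplus_le_objective hx
    exact le_trans (by exact_mod_cast hle ⟨T, hT, rfl⟩) hTx

lemma exists_isIPValue (G : SimpleGraph (U ⊕ V)) (u : U) : ∃ z, IsIPValue G u z := by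
  simp only [isIPValue_iff]
  obtain ⟨S, hS, hmin⟩ := Set.exists_min_image {S : Finset U | u ∈ S} (surplus (biadj G))
    (Set.toFinite _) ⟨{u}, Finset.mem_singleton_self u⟩
  refine ⟨_, ⟨S, hS, rfl⟩, ?_⟩
  rintro _ ⟨T, hT, rfl⟩
  exact hmin T hT

theorem IsIPValue.isLPValue {G : SimpleGraph (U ⊕ V)} {u : U} {z : ℤ} (h : IsIPValue G u z) :
    IsLPValue G u z := by
  obtain ⟨x, hx, hmin⟩ := exists_ipFeasible_forall_lpFeasible_le G u
  have hxz : objective x = z := by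
    refine le_antisymm ?_ (h.2 ⟨x, hx, rfl⟩)
    obtain ⟨y, hy, hyz⟩ := h.1
    exact hyz ▸ hmin y hy.1
  refine ⟨⟨x, hx.1, hxz⟩, ?_⟩
  rintro _ ⟨y, hy, rfl⟩
  exact hxz ▸ hmin y hy

lemma isLeast_isIPValue_iff {G : SimpleGraph (U ⊕ V)} {z : ℤ} :
    IsLeast {y : ℤ | ∃ u : U, IsIPValue G u y} z ↔
      IsLeast (surplus (biadj G) '' {S | S.Nonempty}) z := by
  constructor
  · rintro ⟨⟨u, hu⟩, hle⟩
    obtain ⟨S, hS, hSz⟩ := (isIPValue_iff.mp hu).1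
    refine ⟨⟨S, ⟨u, hS⟩, hSz⟩, ?_⟩
    rintro _ ⟨T, ⟨a, ha⟩, rfl⟩
    obtain ⟨y, hy⟩ := exists_isIPValue G a
    exact (hle ⟨a, hy⟩).trans ((isIPValue_iff.mp hy).2 ⟨T, ha, rfl⟩)
  · rintro ⟨⟨S, ⟨u, hu⟩, rfl⟩, hle⟩
    refine ⟨⟨u, isIPValue_iff.mpr ⟨⟨S, hu, rfl⟩, ?_⟩⟩, ?_⟩
    · rintro _ ⟨T, hT, rfl⟩
      exact hle ⟨T, ⟨u, hT⟩, rfl⟩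
    · rintro y ⟨a, ha⟩
      obtain ⟨T, hT, rfl⟩ := (isIPValue_iff.mp ha).1
      exact hle ⟨T, ⟨a, hT⟩, rfl⟩

end LinearProgram

/-! ### Complete matchings and Hall's theorem -/

section Matching

variable {U V : Type*} {G : SimpleGraph (U ⊕ V)}

lemma Bipartite.exists_inr_of_adj (hG : Bipartite G) {u : U} {w : U ⊕ V}
    (h : G.Adj (Sum.inl u) w) : ∃ v, w = Sum.inr v := by
  rcases hG.mem_of_adj h with ⟨_, v, rfl⟩ | ⟨⟨v, hv⟩, _⟩
  · exact ⟨v, rfl⟩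
  · simp at hv

/-- Bipartiteness puts the partner of each vertex of $U$ into $V$, so a matching that covers $U$
contains the graph of an injection; conversely the graph of an injection is a matching. -/
lemma hasCompleteMatching_iff_exists_injective (hG : Bipartite G) {V' : Finset V} :
    HasCompleteMatching G V' ↔
      ∃ f : U → V, f.Injective ∧ ∀ u, f u ∈ V' ∧ biadj G u (f u) := by
  constructor
  · rintro ⟨M, hle, hM, hU⟩
    have key : ∀ u, ∃ v, M.Adj (Sum.inl u) (Sum.inr v) := by
      intro u
      obtain ⟨w, hw, _⟩ := hM (hU ⟨u, rfl⟩)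
      obtain ⟨v, rfl⟩ := hG.exists_inr_of_adj hw.adj_sub
      exact ⟨v, hw⟩
    choose f hf using key
    refine ⟨f, fun a b hab => ?_, fun u => ⟨?_, (hf u).adj_sub⟩⟩
    · have h1 := hf a
      rw [hab] at h1
      exact Sum.inl_injective (hM.eq_of_adj_right h1 (hf b))
    · have := hle.1 (M.edge_vert (hf u).symm)
      simpa using this
  · rintro ⟨f, hinj, hf⟩
    refine ⟨{ verts := Set.range Sum.inl ∪ Set.range (fun u => Sum.inr (f u))
              Adj := fun a b => ∃ u, (a = Sum.inl u ∧ b = Sum.inr (f u)) ∨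
                (b = Sum.inl u ∧ a = Sum.inr (f u))
              adj_sub := ?_
              edge_vert := ?_
              symm := ⟨?_⟩ }, ⟨?_, ?_⟩, ?_, Set.subset_union_left⟩
    · rintro a b ⟨u, ⟨rfl, rfl⟩ | ⟨rfl, rfl⟩⟩
      · exact (hf u).2
      · exact (hf u).2.symm
    · rintro a b ⟨u, ⟨rfl, rfl⟩ | ⟨rfl, rfl⟩⟩
      · exact Or.inl ⟨u, rfl⟩
      · exact Or.inr ⟨u, rfl⟩
    · rintro a b ⟨u, h⟩
      exact ⟨u, h.symm⟩
    · rintro _ (⟨u, rfl⟩ | ⟨u, rfl⟩)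
      · exact Or.inl ⟨u, rfl⟩
      · exact Or.inr ⟨f u, (hf u).1, rfl⟩
    · rintro a b ⟨u, ⟨rfl, rfl⟩ | ⟨rfl, rfl⟩⟩
      · exact ⟨Or.inl ⟨u, rfl⟩, Or.inr ⟨f u, (hf u).1, rfl⟩, (hf u).2⟩
      · exact ⟨Or.inr ⟨f u, (hf u).1, rfl⟩, Or.inl ⟨u, rfl⟩, (hf u).2.symm⟩
    · rintro _ (⟨u, rfl⟩ | ⟨u, rfl⟩)
      · refine ⟨Sum.inr (f u), ⟨u, Or.inl ⟨rfl, rfl⟩⟩, ?_⟩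
        rintro w ⟨a, ⟨h1, rfl⟩ | ⟨_, h2⟩⟩
        · rw [Sum.inl_injective h1]
        · simp at h2
      · refine ⟨Sum.inl u, ⟨u, Or.inr ⟨rfl, rfl⟩⟩, ?_⟩
        rintro w ⟨a, ⟨h1, _⟩ | ⟨rfl, h2⟩⟩
        · simp at h1
        · rw [hinj (Sum.inr_injective h2)]

variable [Fintype V]

lemma hasCompleteMatching_iff_hall [DecidableEq V] (hG : Bipartite G) {V' : Finset V} :
    HasCompleteMatching G V' ↔ ∀ S : Finset U, S.card ≤ (nbr (biadj G) S ∩ V').card := by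
  classical
  have h := Finset.all_card_le_biUnion_card_iff_exists_injective
    (fun u : U => V'.filter (fun v => biadj G u v))
  simp only [Finset.mem_filter] at h
  rw [hasCompleteMatching_iff_exists_injective hG, ← h]
  refine forall_congr' fun S => ?_
  have : S.biUnion (fun u : U => V'.filter (fun v => biadj G u v)) = nbr (biadj G) S ∩ V' := by
    ext v
    simp only [Finset.mem_biUnion, Finset.mem_filter, Finset.mem_inter, mem_nbr]
    grind
  rw [this]

lemma isKCM_iff [Fintype U] [Nonempty U] (hG : Bipartite G) {k : ℕ} :
    IsKCM G k ↔ ∀ S : Finset U, S.Nonempty → (k : ℤ) ≤ surplus (biadj G) S := by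
  classical
  simp only [IsKCM, hasCompleteMatching_iff_hall hG, surplus]
  constructor
  · rintro ⟨hk, h⟩ S hS
    by_contra! hlt
    -- To refute a set of surplus below $k$, delete $k$ of its neighbours or, if there are fewer
    -- than $k$, delete them all along with further vertices. Either way Hall's condition fails for
    -- $S$.
    by_cases hkN : k ≤ (nbr (biadj G) S).card
    · obtain ⟨T, hT, hTk⟩ := Finset.exists_subset_card_eq hkN
      have h1 := h Tᶜ (by rw [Finset.card_compl, hTk]) S
      have h2 : nbr (biadj G) S ∩ Tᶜ = nbr (biadj G) S \ T := by
        rw [Finset.sdiff_eq_inter_compl]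
      rw [h2, Finset.card_sdiff_of_subset hT] at h1
      omega
    · obtain ⟨T, hT, hTk⟩ := Finset.exists_superset_card_eq (n := k)
        (s := nbr (biadj G) S) (by omega) hk
      have h1 := h Tᶜ (by rw [Finset.card_compl, hTk]) S
      have h2 : nbr (biadj G) S ∩ Tᶜ = ∅ := by
        rw [← Finset.sdiff_eq_inter_compl, Finset.sdiff_eq_empty_iff_subset]
        exact hT
      rw [h2, Finset.card_empty] at h1
      have := hS.card_pos
      omega
  · intro h
    have hk : k ≤ Fintype.card V := by
      have h1 := h Finset.univ Finset.univ_nonempty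
      have h2 := Finset.card_le_univ (nbr (biadj G) (Finset.univ : Finset U))
      omega
    refine ⟨hk, fun V' hV' S => ?_⟩
    rcases S.eq_empty_or_nonempty with rfl | hS
    · simp
    -- Deleting $k$ vertices removes at most $k$ neighbours of $S$.
    · have h1 := h S hS
      have h2 := Finset.card_union_add_card_inter (nbr (biadj G) S) V'
      have h3 := Finset.card_le_univ (nbr (biadj G) S ∪ V')
      omega

theorem isKappa_iff [Fintype U] [Nonempty U] (hG : Bipartite G) {z : ℤ}
    (hz : IsLeast (surplus (biadj G) '' {S | S.Nonempty}) z) (κ : ℕ) :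
    IsKappa G κ ↔ (κ : ℤ) = z := by
  have hk : ∀ k : ℕ, IsKCM G k ↔ (k : ℤ) ≤ z := by
    intro k
    rw [isKCM_iff hG]
    obtain ⟨⟨S, hS, hSz⟩, hle⟩ := hz
    refine ⟨fun h => hSz ▸ h S hS, fun h T hT => h.trans (hle ⟨T, hT, rfl⟩)⟩
  simp only [IsKappa, IsGreatest, Set.mem_ofPred_eq, hk, upperBounds]
  constructor
  · rintro ⟨h1, h2⟩
    -- The bound $\kappa\le z$ already makes $z$ nonnegative, so `z.toNat` is $z$ itself.
    have := h2 (a := z.toNat) (by omega)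
    omega
  · rintro rfl
    exact ⟨le_rfl, fun k h => by exact_mod_cast h⟩

end Matching

/-! ### The auction algorithm

To compute the minimum of `|N(S)| - |S|` over the sets `S` that contain `u₀`, the vertices of `U`
bid in turn for their cheapest neighbour, raising its price by one and displacing its owner, and
give up when all their neighbours have the maximal price. The neighbours of `u₀` have that price
from the start. -/

/-- The invariant of the auction: `pr` are the prices, `own` the owners, `R` is the set of vertices
that have entered, `D` the set of those that have given up, `cur` is the active vertex. -/
structure AuctionInv {U V : Type*} (A : U → V → Prop) (L : ℕ) (u₀ : U) (R : Finset U)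
    (pr : V → ℕ) (own : V → Option U) (D : Finset U) (cur : Option U) : Prop where
  pr_le : ∀ v, pr v ≤ L
  -- Every $S\ni u_0$ has these vertices among its neighbours, so they must not be available as
  -- partners.
  pr_forced : ∀ v, A u₀ v → pr v = L
  pr_unowned : ∀ v, ¬ A u₀ v → own v = none → pr v = 0
  own_adj : ∀ v u, own v = some u → A u v
  own_not_adj : ∀ v u, own v = some u → ¬ A u₀ v
  -- Complementary slackness up to one unit: each owner holds an almost cheapest neighbour.
  own_min : ∀ v u, own v = some u → ∀ w, A u w → pr v ≤ pr w + 1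
  own_inj : ∀ v w u, own v = some u → own w = some u → v = w
  own_mem : ∀ v u, own v = some u → u ∈ R
  own_notMem : ∀ v u, own v = some u → u ∉ D
  dead_pr : ∀ u ∈ D, ∀ v, A u v → pr v = L
  dead_subset : D ⊆ R
  cover : ∀ u ∈ R, u ∈ D ∨ (∃ v, own v = some u) ∨ cur = some u
  cur_mem : ∀ u, cur = some u → u ∈ R
  cur_notMem : ∀ u, cur = some u → u ∉ D
  cur_ne_own : ∀ u, cur = some u → ∀ v, own v ≠ some u

namespace AuctionInv

variable {U V : Type*} {A : U → V → Prop} {L : ℕ} {u₀ : U} {R D : Finset U} {pr : V → ℕ}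
  {own : V → Option U}

lemma init {pr : V → ℕ} (h1 : ∀ v, A u₀ v → pr v = L) (h0 : ∀ v, ¬ A u₀ v → pr v = 0) :
    AuctionInv A L u₀ ∅ pr (fun _ => none) ∅ none where
  pr_le v := by
    by_cases h : A u₀ v
    · exact (h1 v h).le
    · rw [h0 v h]; exact Nat.zero_le _
  pr_forced := h1
  pr_unowned v h _ := h0 v h
  own_adj := by simp
  own_not_adj := by simp
  own_min := by simp
  own_inj := by simp
  own_mem := by simp
  own_notMem := by simp
  dead_pr := by simp
  dead_subset := by simp
  cover := by simp
  cur_mem := by simp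
  cur_notMem := by simp
  cur_ne_own := by simp

lemma enter [DecidableEq U] (h : AuctionInv A L u₀ R pr own D none) {u : U} (hu : u ∉ R) :
    AuctionInv A L u₀ (insert u R) pr own D (some u) :=
  { h with
    own_mem := fun v a ha => Finset.mem_insert_of_mem (h.own_mem v a ha)
    dead_subset := h.dead_subset.trans (Finset.subset_insert _ _)
    cover := by
      intro a ha
      rcases Finset.mem_insert.mp ha with rfl | ha
      · exact Or.inr (Or.inr rfl)
      · rcases h.cover a ha with h1 | h1 | h1
        · exact Or.inl h1
        · exact Or.inr (Or.inl h1)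
        · simp at h1
    cur_mem := by rintro a ⟨rfl⟩; simp
    cur_notMem := by rintro a ⟨rfl⟩ ha; exact hu (h.dead_subset ha)
    cur_ne_own := by rintro a ⟨rfl⟩ v hv; exact hu (h.own_mem v _ hv) }

/-- The slackness `own_min` holds for the bidder because $v$ was cheapest before the increase, and
for the others because prices only rise. The displaced owner, if any, becomes the active vertex. -/
lemma bid [DecidableEq V] {u : U} (h : AuctionInv A L u₀ R pr own D (some u)) {v : V}
    (huv : A u v) (hv : pr v < L) (hmin : ∀ w, A u w → pr v ≤ pr w) :
    AuctionInv A L u₀ R (Function.update pr v (pr v + 1)) (Function.update own v (some u)) D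
      (own v) := by
  have hv0 : ¬ A u₀ v := fun h0 => hv.ne (h.pr_forced v h0)
  have hmono : ∀ w, pr w ≤ Function.update pr v (pr v + 1) w := by
    intro w
    by_cases hw : w = v
    · subst hw; simp
    · simp [hw]
  have hown : ∀ w a, Function.update own v (some u) w = some a →
      (w = v ∧ a = u) ∨ (w ≠ v ∧ own w = some a) := by
    intro w a hwa
    by_cases hw : w = v
    · subst hw
      simp only [Function.update_self, Option.some.injEq] at hwa
      exact Or.inl ⟨rfl, hwa.symm⟩
    · exact Or.inr ⟨hw, by simpa [hw] using hwa⟩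
  have hne : ∀ a, own v = some a → a ≠ u := by
    rintro a ha rfl
    exact h.cur_ne_own a rfl v ha
  have hother : ∀ w, w ≠ v → Function.update pr v (pr v + 1) w = pr w := fun w hw => by simp [hw]
  have hLne : ∀ w, pr w = L → w ≠ v := by rintro w hw rfl; exact hv.ne hw
  constructor
  · intro w
    by_cases hw : w = v
    · subst hw; simp; omega
    · rw [hother w hw]; exact h.pr_le w
  · intro w hw
    rw [hother w (hLne w (h.pr_forced w hw))]
    exact h.pr_forced w hw
  · intro w hw0 hw
    have hwv : w ≠ v := by rintro rfl; simp at hw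
    rw [hother w hwv]
    exact h.pr_unowned w hw0 (by simpa [hwv] using hw)
  · intro w a hwa
    rcases hown w a hwa with ⟨rfl, rfl⟩ | ⟨_, hwa⟩
    · exact huv
    · exact h.own_adj w a hwa
  · intro w a hwa
    rcases hown w a hwa with ⟨rfl, rfl⟩ | ⟨_, hwa⟩
    · exact hv0
    · exact h.own_not_adj w a hwa
  · intro w a hwa x hx
    rcases hown w a hwa with ⟨rfl, rfl⟩ | ⟨hwv, hwa⟩
    · rw [Function.update_self]
      exact Nat.add_le_add_right ((hmin x hx).trans (hmono x)) 1
    · rw [hother w hwv]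
      exact (h.own_min w a hwa x hx).trans (Nat.add_le_add_right (hmono x) 1)
  · intro w x a hw hx
    rcases hown w a hw with ⟨h1, h2⟩ | ⟨h1, h2⟩ <;>
    rcases hown x a hx with ⟨h3, h4⟩ | ⟨h3, h4⟩
    · rw [h1, h3]
    · exact absurd (h2 ▸ h4) (h.cur_ne_own u rfl x)
    · exact absurd (h4 ▸ h2) (h.cur_ne_own u rfl w)
    · exact h.own_inj w x a h2 h4
  · intro w a hwa
    rcases hown w a hwa with ⟨_, rfl⟩ | ⟨_, hwa⟩
    · exact h.cur_mem a rfl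
    · exact h.own_mem w a hwa
  · intro w a hwa
    rcases hown w a hwa with ⟨_, rfl⟩ | ⟨_, hwa⟩
    · exact h.cur_notMem a rfl
    · exact h.own_notMem w a hwa
  · intro a ha w hw
    rw [hother w (hLne w (h.dead_pr a ha w hw))]
    exact h.dead_pr a ha w hw
  · exact h.dead_subset
  · intro a ha
    rcases h.cover a ha with h1 | ⟨w, hw⟩ | h1
    · exact Or.inl h1
    · by_cases hwv : w = v
      · subst hwv; exact Or.inr (Or.inr hw)
      · exact Or.inr (Or.inl ⟨w, by simpa [hwv] using hw⟩)
    · exact Or.inr (Or.inl ⟨v, by simpa using h1⟩)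
  · exact fun a ha => h.own_mem v a ha
  · exact fun a ha => h.own_notMem v a ha
  · intro a ha w hw
    rcases hown w a hw with ⟨_, rfl⟩ | ⟨hwv, hw⟩
    · exact hne a ha rfl
    · exact hwv (h.own_inj w v a hw ha)

/-- Prices never exceed $L$, so here all neighbours have price exactly $L$. -/
lemma giveUp [DecidableEq U] {u : U} (h : AuctionInv A L u₀ R pr own D (some u))
    (hmax : ∀ v, A u v → L ≤ pr v) : AuctionInv A L u₀ R pr own (insert u D) none :=
  { h with
    own_notMem := by
      intro v a ha hmem
      rcases Finset.mem_insert.mp hmem with rfl | hmem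
      · exact h.cur_ne_own a rfl v ha
      · exact h.own_notMem v a ha hmem
    dead_pr := by
      intro a ha v hv
      rcases Finset.mem_insert.mp ha with rfl | ha
      · exact le_antisymm (h.pr_le v) (hmax v hv)
      · exact h.dead_pr a ha v hv
    dead_subset := Finset.insert_subset (h.cur_mem u rfl) h.dead_subset
    cover := by
      intro a ha
      rcases h.cover a ha with h1 | h1 | h1
      · exact Or.inl (Finset.mem_insert_of_mem h1)
      · exact Or.inr (Or.inl h1)
      · exact Or.inl (Finset.mem_insert.mpr (Or.inl (Option.some.inj h1).symm))
    cur_mem := by simp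
    cur_notMem := by simp
    cur_ne_own := by simp }

/-- The termination measure of the auction. -/
lemma sum_sub_update_lt [Fintype V] [DecidableEq V] {v : V} (hv : pr v < L) :
    ∑ w, (L - Function.update pr v (pr v + 1) w) < ∑ w, (L - pr w) := by
  refine Finset.sum_lt_sum (fun w _ => ?_) ⟨v, Finset.mem_univ v, ?_⟩
  · by_cases hw : w = v
    · subst hw; rw [Function.update_self]; omega
    · simp [hw]
  · rw [Function.update_self]; omega

/-! ### Optimality of the final state of the auction. -/

variable [Fintype U] [Fintype V]

lemma sub_card_le_surplus (h : AuctionInv A L u₀ Finset.univ pr own D none) {S : Finset U}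
    (hS : u₀ ∈ S) : ((nbr A {u₀}).card : ℤ) - D.card ≤ surplus A S := by
  classical
  have h1 : nbr A {u₀} ⊆ nbr A S := by
    intro v hv
    obtain ⟨u, hu, huv⟩ := mem_nbr.mp hv
    rw [Finset.mem_singleton.mp hu] at huv
    exact mem_nbr.mpr ⟨u₀, hS, huv⟩
  -- Each vertex of $S\setminus D$ owns a vertex of $N(S)\setminus N(u_0)$, and a vertex has only
  -- one owner. The default `u₀` for unowned vertices plays no role in surjectivity.
  have h2 : (S \ D).card ≤ (nbr A S \ nbr A {u₀}).card := by
    refine Finset.card_le_card_of_surjOn (fun v => (own v).getD u₀) ?_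
    intro u hu
    obtain ⟨hu1, hu2⟩ := Finset.mem_sdiff.mp hu
    rcases h.cover u (Finset.mem_univ u) with h3 | ⟨v, hv⟩ | h3
    · exact absurd h3 hu2
    · refine ⟨v, Finset.mem_sdiff.mpr ⟨mem_nbr.mpr ⟨u, hu1, h.own_adj v u hv⟩, fun hm => ?_⟩,
        by simp [hv]⟩
      obtain ⟨a, ha, hav⟩ := mem_nbr.mp hm
      rw [Finset.mem_singleton.mp ha] at hav
      exact h.own_not_adj v u hv hav
    · simp at h3
  rw [Finset.card_sdiff_of_subset h1] at h2
  have h3 := Finset.le_card_sdiff D S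
  have h4 := Finset.card_le_card h1
  simp only [surplus]
  omega

/-- Some price level between `1` and `L - 1` is not taken. -/
lemma exists_gap (pr : V → ℕ) (hL : Fintype.card V + 2 ≤ L) :
    ∃ k, 1 ≤ k ∧ k < L ∧ ∀ v, pr v ≠ k := by
  classical
  -- There are $L-1>|V|$ levels but at most $|V|$ different prices.
  obtain ⟨k, hk, hk'⟩ := Finset.exists_mem_notMem_of_card_lt_card
    (s := Finset.univ.image pr) (t := Finset.Ico 1 L) (by
      have := Finset.card_image_le (s := (Finset.univ : Finset V)) (f := pr)
      simp only [Finset.card_univ, Nat.card_Ico] at this ⊢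
      omega)
  rw [Finset.mem_Ico] at hk
  exact ⟨k, hk.1, hk.2, fun v hv => hk' (Finset.mem_image.mpr ⟨v, Finset.mem_univ v, hv⟩)⟩

lemma exists_surplus_le (h : AuctionInv A L u₀ Finset.univ pr own D none)
    (hL : Fintype.card V + 2 ≤ L) :
    ∃ S : Finset U, u₀ ∈ S ∧ surplus A S ≤ ((nbr A {u₀}).card : ℤ) - D.card := by
  classical
  obtain ⟨k, hk1, hkL, hgap⟩ := exists_gap pr hL
  -- The optimal set will be $D\cup W$, with $N(D\cup W)\subseteq N(u_0)\cup T$ and $|T|\le|W|$.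
  set T : Finset V := {v | k < pr v ∧ ¬ A u₀ v} with hT
  set W : Finset U := {u | ∃ v, k < pr v ∧ own v = some u} with hW
  have hown : ∀ v ∈ T, ∃ u, own v = some u := by
    intro v hv
    obtain ⟨hv1, hv2⟩ : k < pr v ∧ ¬ A u₀ v := by simpa [hT] using hv
    cases ho : own v with
    | none => have := h.pr_unowned v hv2 ho; omega
    | some u => exact ⟨u, rfl⟩
  have hTW : T.card ≤ W.card := by
    refine Finset.card_le_card_of_injOn (fun v => (own v).getD u₀) ?_ ?_
    · intro v hv
      obtain ⟨u, hu⟩ := hown v hv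
      have hv' : k < pr v ∧ ¬ A u₀ v := by simpa [hT] using hv
      simp only [hu, Option.getD_some, hW, Finset.coe_filter, Finset.mem_univ, true_and]
      exact ⟨v, hv'.1, hu⟩
    · intro v hv w hw hvw
      obtain ⟨u, hu⟩ := hown v hv
      obtain ⟨a, ha⟩ := hown w hw
      simp only [hu, ha, Option.getD_some] at hvw
      subst hvw
      exact h.own_inj v w u hu ha
  have hdisj : Disjoint D W := by
    rw [Finset.disjoint_right]
    intro u hu
    obtain ⟨v, _, hv⟩ : ∃ v, k < pr v ∧ own v = some u := by simpa [hW] using hu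
    exact h.own_notMem v u hv
  have hu₀ : u₀ ∈ D := by
    rcases h.cover u₀ (Finset.mem_univ _) with h1 | ⟨v, hv⟩ | h1
    · exact h1
    · exact absurd (h.own_adj v u₀ hv) (h.own_not_adj v u₀ hv)
    · simp at h1
  have hN : nbr A (D ∪ W) ⊆ nbr A {u₀} ∪ T := by
    intro v hv
    obtain ⟨u, hu, huv⟩ := mem_nbr.mp hv
    by_cases h0 : A u₀ v
    · exact Finset.mem_union_left _ (mem_nbr.mpr ⟨u₀, by simp, h0⟩)
    · refine Finset.mem_union_right _ ?_
      -- Slackness loses one unit and gives only $k\le$ `pr v`; since no price equals $k$, the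
      -- inequality is strict.
      suffices k ≤ pr v by
        have := hgap v
        simp only [hT, Finset.mem_filter, Finset.mem_univ, true_and]
        exact ⟨by omega, h0⟩
      rcases Finset.mem_union.mp hu with hu | hu
      · rw [h.dead_pr u hu v huv]; exact hkL.le
      · obtain ⟨w, hw, hwu⟩ : ∃ v, k < pr v ∧ own v = some u := by simpa [hW] using hu
        have := h.own_min w u hwu v huv
        omega
  refine ⟨D ∪ W, Finset.mem_union_left _ hu₀, ?_⟩
  have h1 := Finset.card_le_card hN
  have h2 := Finset.card_union_le (nbr A {u₀}) T
  simp only [surplus, Finset.card_union_of_disjoint hdisj]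
  omega

theorem isLeast_surplus (h : AuctionInv A L u₀ Finset.univ pr own D none)
    (hL : Fintype.card V + 2 ≤ L) :
    IsLeast (surplus A '' {S | u₀ ∈ S}) ((nbr A {u₀}).card - D.card) := by
  obtain ⟨S, hS, hle⟩ := h.exists_surplus_le hL
  refine ⟨⟨S, hS, le_antisymm hle (h.sub_card_le_surplus hS)⟩, ?_⟩
  rintro _ ⟨T, hT, rfl⟩
  exact h.sub_card_le_surplus hT

end AuctionInv

/-! ### Reasoning about programs -/

@[simp] lemma Store.setReg_reg (s : Store) (i c j : ℕ) :
    (s.setReg i c).reg j = if j = i then c else s.reg j := by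
  simp [Store.setReg, Function.update_apply]

@[simp] lemma Store.setReg_arr (s : Store) (i c : ℕ) : (s.setReg i c).arr = s.arr := rfl

@[simp] lemma Store.setArr_reg (s : Store) (a p c : ℕ) : (s.setArr a p c).reg = s.reg := rfl

@[simp] lemma Store.setArr_arr (s : Store) (a p c b q : ℕ) :
    (s.setArr a p c).arr b q = if b = a ∧ q = p then c else s.arr b q := by
  by_cases hb : b = a
  · subst hb
    simp [Store.setArr, Function.update_apply]
  · simp [Store.setArr, hb]

/-- The program contains an assignment to the register `r`. -/
def Prog.writesReg (r : ℕ) : Prog → Bool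
  | .skip => false
  | .const i _ => i == r
  | .copy i _ => i == r
  | .add i _ _ => i == r
  | .sub i _ _ => i == r
  | .load i _ _ => i == r
  | .store _ _ _ => false
  | .seq P Q => P.writesReg r || Q.writesReg r
  | .ite _ P Q => P.writesReg r || Q.writesReg r
  | .loop _ P => P.writesReg r

/-- The program contains an assignment to the array `a`. -/
def Prog.writesArr (a : ℕ) : Prog → Bool
  | .store b _ _ => b == a
  | .seq P Q => P.writesArr a || Q.writesArr a
  | .ite _ P Q => P.writesArr a || Q.writesArr a
  | .loop _ P => P.writesArr a
  | _ => false

/-- The two stores differ only where the program writes. -/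
structure Frame (P : Prog) (s s' : Store) : Prop where
  reg : ∀ r, P.writesReg r = false → s'.reg r = s.reg r
  arr : ∀ a, P.writesArr a = false → s'.arr a = s.arr a

lemma Frame.refl (P : Prog) (s : Store) : Frame P s s := ⟨fun _ _ => rfl, fun _ _ => rfl⟩

lemma Frame.trans {P : Prog} {s s' s'' : Store} (h : Frame P s s') (h' : Frame P s' s'') :
    Frame P s s'' :=
  ⟨fun r hr => (h'.reg r hr).trans (h.reg r hr), fun a ha => (h'.arr a ha).trans (h.arr a ha)⟩

lemma frame_setReg {P : Prog} {s : Store} {i c : ℕ} (h : ∀ r, P.writesReg r = false → r ≠ i) :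
    Frame P s (s.setReg i c) :=
  ⟨fun r hr => by simp [h r hr], fun _ _ => rfl⟩

/-- Carries untouched registers and arrays across a subprogram: for a concrete program, `writesReg`
and `writesArr` evaluate, so the side conditions hold by `rfl`. -/
lemma Runs.frame {P : Prog} {s s' : Store} {t : ℕ} (h : Runs P s t s') : Frame P s s' := by
  induction h with
  | skip s => exact Frame.refl _ _
  | const | copy | add | sub | load =>
    refine frame_setReg fun r hr => ?_
    rintro rfl
    simp [Prog.writesReg] at hr
  | store s a i j =>
    refine ⟨fun _ _ => rfl, fun b hb => ?_⟩
    have hba : b ≠ a := by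
      rintro rfl
      simp [Prog.writesArr] at hb
    funext q
    simp [hba]
  | seq _ _ h1 h2 =>
    refine ⟨fun r hr => ?_, fun a ha => ?_⟩
    · simp only [Prog.writesReg, Bool.or_eq_false_iff] at hr
      rw [h2.reg r hr.2, h1.reg r hr.1]
    · simp only [Prog.writesArr, Bool.or_eq_false_iff] at ha
      rw [h2.arr a ha.2, h1.arr a ha.1]
  | ite_true _ _ h1 =>
    refine ⟨fun r hr => ?_, fun a ha => ?_⟩
    · simp only [Prog.writesReg, Bool.or_eq_false_iff] at hr
      exact h1.reg r hr.1
    · simp only [Prog.writesArr, Bool.or_eq_false_iff] at ha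
      exact h1.arr a ha.1
  | ite_false _ _ h1 =>
    refine ⟨fun r hr => ?_, fun a ha => ?_⟩
    · simp only [Prog.writesReg, Bool.or_eq_false_iff] at hr
      exact h1.reg r hr.2
    · simp only [Prog.writesArr, Bool.or_eq_false_iff] at ha
      exact h1.arr a ha.2
  | loop_done _ => exact Frame.refl _ _
  | loop_step _ _ _ h1 h2 =>
    exact ⟨fun r hr => (h2.reg r hr).trans (h1.reg r hr),
      fun a ha => (h2.arr a ha).trans (h1.arr a ha)⟩

/-! ### Total correctness with a bound on the number of steps. -/

/-- Started in `s`, the program halts after at most `B` steps in a store that satisfies `Q`. -/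
def Within (P : Prog) (s : Store) (B : ℕ) (Q : Store → Prop) : Prop :=
  ∃ t s', Runs P s t s' ∧ t ≤ B ∧ Q s'

namespace Within

variable {P P' : Prog} {s : Store} {B B' : ℕ} {Q R : Store → Prop} {a i j k c : ℕ}

lemma mono (h : Within P s B Q) (hB : B ≤ B') (hQ : ∀ s', Frame P s s' → Q s' → R s') :
    Within P s B' R := by
  obtain ⟨t, s', hr, ht, hq⟩ := h
  exact ⟨t, s', hr, ht.trans hB, hQ s' hr.frame hq⟩

lemma skip (h : Q s) : Within .skip s (B + 1) Q := ⟨1, s, .skip s, by omega, h⟩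

lemma const (h : Q (s.setReg i c)) : Within (.const i c) s (B + 1) Q :=
  ⟨1, _, .const s i c, by omega, h⟩

lemma copy (h : Q (s.setReg i (s.reg j))) : Within (.copy i j) s (B + 1) Q :=
  ⟨1, _, .copy s i j, by omega, h⟩

lemma add (h : Q (s.setReg i (s.reg j + s.reg k))) : Within (.add i j k) s (B + 1) Q :=
  ⟨1, _, .add s i j k, by omega, h⟩

lemma sub (h : Q (s.setReg i (s.reg j - s.reg k))) : Within (.sub i j k) s (B + 1) Q :=
  ⟨1, _, .sub s i j k, by omega, h⟩

lemma load (h : Q (s.setReg i (s.arr a (s.reg j)))) : Within (.load i a j) s (B + 1) Q :=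
  ⟨1, _, .load s i a j, by omega, h⟩

lemma store (h : Q (s.setArr a (s.reg i) (s.reg j))) : Within (.store a i j) s (B + 1) Q :=
  ⟨1, _, .store s a i j, by omega, h⟩

lemma seq (h : Within P s B fun s' => Frame P s s' → Within P' s' B' Q) :
    Within (.seq P P') s (B + B') Q := by
  obtain ⟨t, s', hr, ht, h'⟩ := h
  obtain ⟨t', s'', hr', ht', hq⟩ := h' hr.frame
  exact ⟨t + t', s'', hr.seq hr', by omega, hq⟩

lemma seq_atom (h : Within P s 1 fun s' => Within P' s' B Q) :
    Within (.seq P P') s (B + 1) Q := by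
  rw [Nat.add_comm]
  exact seq (h.mono le_rfl fun _ _ h' _ => h')

lemma seq_const (h : Within P (s.setReg i c) B Q) : Within (.seq (.const i c) P) s (B + 1) Q :=
  seq_atom (const h)

lemma seq_copy (h : Within P (s.setReg i (s.reg j)) B Q) :
    Within (.seq (.copy i j) P) s (B + 1) Q := seq_atom (copy h)

lemma seq_add (h : Within P (s.setReg i (s.reg j + s.reg k)) B Q) :
    Within (.seq (.add i j k) P) s (B + 1) Q := seq_atom (add h)

lemma seq_sub (h : Within P (s.setReg i (s.reg j - s.reg k)) B Q) :
    Within (.seq (.sub i j k) P) s (B + 1) Q := seq_atom (sub h)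

lemma seq_load (h : Within P (s.setReg i (s.arr a (s.reg j))) B Q) :
    Within (.seq (.load i a j) P) s (B + 1) Q := seq_atom (load h)

lemma seq_store (h : Within P (s.setArr a (s.reg i) (s.reg j)) B Q) :
    Within (.seq (.store a i j) P) s (B + 1) Q := seq_atom (store h)

lemma ite (h : s.reg i ≠ 0 → Within P s B Q) (h' : s.reg i = 0 → Within P' s B Q) :
    Within (.ite i P P') s (B + 1) Q := by
  by_cases hi : s.reg i = 0
  · obtain ⟨t, s', hr, ht, hq⟩ := h' hi
    exact ⟨t + 1, s', .ite_false hi hr, by omega, hq⟩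
  · obtain ⟨t, s', hr, ht, hq⟩ := h hi
    exact ⟨t + 1, s', .ite_true hi hr, by omega, hq⟩

/-- A loop whose variant `k` decreases. -/
lemma loop {I : ℕ → Store → Prop}
    (h : ∀ k s', I k s' → Frame P s s' → s'.reg i ≠ 0 → ∃ k' < k, Within P s' B (I k')) {k : ℕ}
    (hI : I k s) :
    Within (.loop i P) s (k * (B + 1) + 1) fun s' => s'.reg i = 0 ∧ ∃ k', I k' s' := by
  suffices H : ∀ k s', I k s' → Frame P s s' →
      Within (.loop i P) s' (k * (B + 1) + 1) fun s' => s'.reg i = 0 ∧ ∃ k', I k' s' from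
    H k s hI (Frame.refl _ _)
  intro k
  induction k using Nat.strong_induction_on with
  | _ k ih =>
    intro s₁ hI₁ hF₁
    by_cases hi : s₁.reg i = 0
    · exact ⟨1, s₁, .loop_done hi, by omega, hi, k, hI₁⟩
    · obtain ⟨k', hk', t, s₂, hr, ht, hI₂⟩ := h k s₁ hI₁ hF₁ hi
      obtain ⟨t', s₃, hr', ht', hq⟩ := ih k' hk' s₂ hI₂ (hF₁.trans hr.frame)
      refine ⟨_, s₃, .loop_step hi hr hr', ?_, hq⟩
      -- One unit of the variant pays for the body and its test.
      have : (k' + 1) * (B + 1) ≤ k * (B + 1) := Nat.mul_le_mul_right _ hk'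
      rw [Nat.add_mul] at this
      omega

/-- A loop that counts its register down to `0`. -/
lemma countdown {I : ℕ → Store → Prop}
    (h : ∀ k s', I (k + 1) s' → s'.reg i = k + 1 → Frame P s s' →
      Within P s' B fun s'' => s''.reg i = k ∧ I k s'') {k : ℕ} (hi : s.reg i = k) (hI : I k s) :
    Within (.loop i P) s (k * (B + 1) + 1) (I 0) := by
  refine (loop (I := fun k s' => s'.reg i = k ∧ I k s') ?_ ⟨hi, hI⟩).mono le_rfl ?_
  · rintro k s' ⟨hk, hI⟩ hF hne
    obtain ⟨l, rfl⟩ : ∃ l, k = l + 1 := ⟨k - 1, by omega⟩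
    exact ⟨l, by omega, h l s' hI hk hF⟩
  · rintro s' _ ⟨h0, k', hk', hI'⟩
    rwa [show k' = 0 by omega] at hI'

end Within

/-! ### The program

Registers: `0`, `1`: sizes `m`, `n`; `2`: the maximal price `n + 2`; `3`: the constant `1`;
`4`, `5`: the best value so far as a difference; `6`, `7`: the current `u₀` and its row pointer;
`8`: the degree of `u₀`; `9`: the number of vertices that gave up; `10`, `11`: the entering vertex
and its row pointer; `12`: the active vertex; `13`: an index in `V`; `14`, `15`: the cheapest price
and vertex; `16`, `17`: temporary; `18`: the product `m * n`. Arrays: `1`: prices; `2`: owners.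
A vertex `u` of `U` is stored as `u * n + 1`. -/

/-- Initialize the price and the owner of one vertex of `V`. -/
def resetBody : Prog :=
  .seq (.sub 13 13 3) <| .seq (.add 16 7 13) <| .seq (.load 16 0 16) <| .seq (.const 17 0) <|
  .seq (.store 2 13 17) <| .ite 16 (.seq (.store 1 13 2) (.add 8 8 3)) (.store 1 13 17)

/-- Initialize the prices and the owners. -/
def reset : Prog :=
  .seq (.const 8 0) <| .seq (.const 9 0) <| .seq (.copy 13 1) <| .loop 13 resetBody

/-- Compare one vertex of `V` with the cheapest neighbour found so far. -/
def scanBody : Prog :=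
  -- Register `12` holds the row pointer plus one; subtracting the constant `1` yields the matrix
  -- index.
  .seq (.sub 13 13 3) <| .seq (.add 16 12 13) <| .seq (.sub 16 16 3) <| .seq (.load 16 0 16) <|
  .ite 16 (.seq (.load 17 1 13) <| .seq (.sub 16 14 17) <|
    .ite 16 (.seq (.copy 14 17) (.copy 15 13)) .skip) .skip

/-- Find the cheapest neighbour of the active vertex. -/
def scan : Prog :=
  .seq (.copy 14 2) <| .seq (.copy 13 1) <| .loop 13 scanBody

/-- The active vertex bids or gives up. -/
def bidBody : Prog :=
  .seq scan <| .seq (.sub 16 2 14) <|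
  .ite 16 (.seq (.load 16 2 15) <| .seq (.store 2 15 12) <| .seq (.add 17 14 3) <|
      .seq (.store 1 15 17) <| .copy 12 16)
    (.seq (.add 9 9 3) (.const 12 0))

/-- One vertex enters the auction. -/
def enterBody : Prog :=
  .seq (.sub 10 10 3) <| .seq (.sub 11 11 1) <| .seq (.add 12 11 3) <| .loop 12 bidBody

/-- All vertices enter the auction. -/
def auction : Prog :=
  .seq (.copy 10 0) <| .seq (.copy 11 18) <| .loop 10 enterBody

/-- Compute the value of one `u₀`, and update the minimum. -/
def valueBody : Prog :=
  .seq (.sub 6 6 3) <| .seq (.sub 7 7 1) <| .seq reset <| .seq auction <|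
  -- Differences are compared by cross addition: the truncated difference is nonzero exactly when
  -- `reg 8 - reg 9 < reg 4 - reg 5` holds in the integers.
  .seq (.add 16 8 5) <| .seq (.add 17 4 9) <| .seq (.sub 16 17 16) <|
  .ite 16 (.seq (.copy 4 8) (.copy 5 9)) .skip

/-- Compute the product `m * n`. -/
def sizeLoop : Prog :=
  .loop 6 <| .seq (.sub 6 6 3) (.add 18 18 1)

/-- The whole program. -/
def blockerProg : Prog :=
  .seq (.const 3 1) <| .seq (.add 2 1 3) <| .seq (.add 2 2 3) <| .seq (.const 18 0) <|
  .seq (.copy 6 0) <| .seq sizeLoop <|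
  .seq (.copy 4 1) <| .seq (.const 5 0) <| .seq (.copy 6 0) <| .seq (.copy 7 18) <|
  .seq (.loop 6 valueBody) <| .seq (.sub 0 4 5) <| .sub 1 5 4

/-! ### Correctness of the program -/

section Correctness

variable {m n : ℕ} {A : Fin m → Fin n → Prop} {s s' : Store} {P : Prog}

/-- The sizes, the constants and the adjacency matrix are in place. -/
structure Base (A : Fin m → Fin n → Prop) (s : Store) : Prop where
  reg_m : s.reg 0 = m
  reg_n : s.reg 1 = n
  reg_L : s.reg 2 = n + 2
  reg_one : s.reg 3 = 1
  reg_size : s.reg 18 = m * n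
  adj : ∀ (i : Fin m) (j : Fin n), s.arr 0 (i * n + j) ≠ 0 ↔ A i j

lemma Base.frame (h : Base A s) (hF : Frame P s s')
    (hP : (P.writesReg 0 || P.writesReg 1 || P.writesReg 2 || P.writesReg 3 || P.writesReg 18 ||
      P.writesArr 0) = false) : Base A s' := by
  simp only [Bool.or_eq_false_iff] at hP
  obtain ⟨⟨⟨⟨⟨h0, h1⟩, h2⟩, h3⟩, h18⟩, ha⟩ := hP
  exact ⟨hF.reg 0 h0 ▸ h.reg_m, hF.reg 1 h1 ▸ h.reg_n, hF.reg 2 h2 ▸ h.reg_L,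
    hF.reg 3 h3 ▸ h.reg_one, hF.reg 18 h18 ▸ h.reg_size, by rw [hF.arr 0 ha]; exact h.adj⟩

/-- How the owner of a vertex is stored. -/
def code : Option (Fin m) → ℕ
  | none => 0
  -- The row pointer is stored directly, since the machine cannot multiply; the shift by one keeps
  -- `0` free for `none`.
  | some u => u * n + 1

lemma code_none : code (m := m) (n := n) none = 0 := rfl

lemma code_some (u : Fin m) : code (n := n) (some u) = u * n + 1 := rfl

open Classical in
lemma within_reset (hB : Base A s) {u₀ : Fin m} (h7 : s.reg 7 = u₀ * n) :
    Within reset s (n * 10 + 4) fun s' =>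
      (∀ v : Fin n, s'.arr 1 v = if A u₀ v then n + 2 else 0) ∧ (∀ v : Fin n, s'.arr 2 v = 0) ∧
      s'.reg 8 = (nbr A {u₀}).card ∧ s'.reg 9 = 0 := by
  refine .seq_const <| .seq_const <| .seq_copy ?_
  set s₁ := ((s.setReg 8 0).setReg 9 0).setReg 13 _ with hs₁
  have hB₁ : Base A s₁ := by
    constructor <;> simp [hs₁, hB.reg_m, hB.reg_n, hB.reg_L, hB.reg_one, hB.reg_size]
    simpa using hB.adj
  refine (Within.countdown (B := 9) (I := fun k s' =>
    (∀ v : Fin n, k ≤ v → s'.arr 1 v = if A u₀ v then n + 2 else 0) ∧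
    (∀ v : Fin n, k ≤ v → s'.arr 2 v = 0) ∧
    s'.reg 8 = Finset.card {v : Fin n | k ≤ v ∧ A u₀ v} ∧ k ≤ n) (k := n) ?_ ?_ ?_).mono le_rfl ?_
  · rintro k s₂ ⟨h1, h2, h8, hk⟩ h13 hF
    have hB₂ := hB₁.frame hF rfl
    have h7₂ : s₂.reg 7 = u₀ * n := by
      rw [hF.reg 7 rfl]; simpa [hs₁] using h7
    have hadj := hB₂.adj u₀ ⟨k, hk⟩
    -- The degree count splits off the vertex $k$ treated in this round.
    have h8' : Finset.card {v : Fin n | k ≤ v ∧ A u₀ v} =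
        Finset.card {v : Fin n | k + 1 ≤ v ∧ A u₀ v} + if A u₀ ⟨k, hk⟩ then 1 else 0 := by
      split_ifs with hA
      · rw [← Finset.card_insert_of_notMem (a := (⟨k, hk⟩ : Fin n)) (by simp)]
        congr 1
        ext v
        simp only [Finset.mem_filter, Finset.mem_univ, true_and, Finset.mem_insert, Fin.ext_iff]
        constructor
        · rintro ⟨hv, hv'⟩
          by_cases h : (v : ℕ) = k
          · exact Or.inl h
          · exact Or.inr ⟨by omega, hv'⟩
        · rintro (h | ⟨hv, hv'⟩)
          · have : v = ⟨k, hk⟩ := Fin.ext h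
            exact ⟨h.ge, this ▸ hA⟩
          · exact ⟨by omega, hv'⟩
      · rw [Nat.add_zero]
        congr 1
        ext v
        simp only [Finset.mem_filter, Finset.mem_univ, true_and]
        constructor
        · rintro ⟨hv, hv'⟩
          refine ⟨?_, hv'⟩
          by_contra hlt
          have : v = ⟨k, hk⟩ := Fin.ext (show (v : ℕ) = k by omega)
          exact hA (this ▸ hv')
        · rintro ⟨hv, hv'⟩
          exact ⟨by omega, hv'⟩
    have hcase : ∀ v : Fin n, k ≤ v → (v : ℕ) = k ∧ v = ⟨k, hk⟩ ∨ (v : ℕ) ≠ k ∧ k + 1 ≤ v := by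
      intro v hv
      by_cases h : (v : ℕ) = k
      · exact Or.inl ⟨h, Fin.ext h⟩
      · exact Or.inr ⟨h, by omega⟩
    refine .seq_sub <| .seq_add <| .seq_load <| .seq_const <| .seq_store <| .ite (fun hne => ?_)
      (fun heq => ?_)
    · have hA : A u₀ ⟨k, hk⟩ := by
        apply hadj.mp
        simpa [h13, hB₂.reg_one, h7₂] using hne
      refine .seq_store <| .add ⟨by simp [h13, hB₂.reg_one], ?_, ?_, ?_, by omega⟩
      · intro v hv
        rcases hcase v hv with ⟨h, rfl⟩ | ⟨h, h'⟩
        · simp [h13, hB₂.reg_one, hB₂.reg_L, hA]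
        · simp [h13, hB₂.reg_one, h, h1 v h']
      · intro v hv
        rcases hcase v hv with ⟨h, _⟩ | ⟨h, h'⟩
        · simp [h13, hB₂.reg_one, h]
        · simp [h13, hB₂.reg_one, h, h2 v h']
      · rw [h8', if_pos hA, ← h8]
        simp [hB₂.reg_one]
    · have hA : ¬ A u₀ ⟨k, hk⟩ := by
        rw [← hadj, not_not]
        simpa [h13, hB₂.reg_one, h7₂] using heq
      refine .store ⟨by simp [h13, hB₂.reg_one], ?_, ?_, ?_, by omega⟩
      · intro v hv
        rcases hcase v hv with ⟨h, rfl⟩ | ⟨h, h'⟩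
        · simp [h13, hB₂.reg_one, hA]
        · simp [h13, hB₂.reg_one, h, h1 v h']
      · intro v hv
        rcases hcase v hv with ⟨h, _⟩ | ⟨h, h'⟩
        · simp [h13, hB₂.reg_one, h]
        · simp [h13, hB₂.reg_one, h, h2 v h']
      · rw [h8', if_neg hA, Nat.add_zero, ← h8]
        simp
  · simp [hs₁, hB.reg_n]
  · refine ⟨fun v hv => absurd v.2 (by omega), fun v hv => absurd v.2 (by omega), ?_, le_rfl⟩
    rw [Finset.card_eq_zero.mpr]
    · simp [hs₁]
    · ext v
      have := v.2
      simp only [Finset.mem_filter, Finset.mem_univ, true_and, Finset.notMem_empty, iff_false]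
      omega
  · rintro s₂ hF ⟨h1, h2, h8, _⟩
    refine ⟨fun v => h1 v (Nat.zero_le _), fun v => h2 v (Nat.zero_le _), ?_, ?_⟩
    · rw [h8]
      congr 1
      ext v
      simp [mem_nbr]
    · rw [hF.reg 9 rfl]
      simp [hs₁]

lemma within_scan (hB : Base A s) {u : Fin m} {pr : Fin n → ℕ} (h12 : s.reg 12 = u * n + 1)
    (h1 : ∀ v : Fin n, s.arr 1 v = pr v) :
    Within scan s (n * 11 + 3) fun s' =>
      (s'.reg 14 = n + 2 ∨
        ∃ v : Fin n, s'.reg 15 = v ∧ s'.reg 14 = pr v ∧ A u v ∧ pr v < n + 2) ∧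
      ∀ w, A u w → s'.reg 14 ≤ pr w := by
  refine .seq_copy <| .seq_copy ?_
  set s₁ := (s.setReg 14 _).setReg 13 _ with hs₁
  have hB₁ : Base A s₁ := by
    constructor <;> simp [hs₁, hB.reg_m, hB.reg_n, hB.reg_L, hB.reg_one, hB.reg_size]
    simpa using hB.adj
  refine (Within.countdown (B := 10) (I := fun k s' =>
    (s'.reg 14 = n + 2 ∨
      ∃ v : Fin n, s'.reg 15 = v ∧ s'.reg 14 = pr v ∧ A u v ∧ pr v < n + 2) ∧
    (∀ w : Fin n, k ≤ w → A u w → s'.reg 14 ≤ pr w) ∧ k ≤ n) (k := n) ?_ ?_ ?_).mono le_rfl ?_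
  · rintro k s₂ ⟨hbest, hmin, hk⟩ h13 hF
    have hB₂ := hB₁.frame hF rfl
    have h12₂ : s₂.reg 12 = u * n + 1 := by
      rw [hF.reg 12 rfl]; simpa [hs₁] using h12
    have h1₂ : ∀ v : Fin n, s₂.arr 1 v = pr v := by
      rw [hF.arr 1 rfl]; simpa [hs₁] using h1
    have hadj := hB₂.adj u ⟨k, hk⟩
    have hpr := h1₂ ⟨k, hk⟩
    simp only at hadj hpr
    have hle : s₂.reg 14 ≤ n + 2 := by
      rcases hbest with h | ⟨v, _, h, _, h'⟩ <;> omega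
    have hidx : (u : ℕ) * n + 1 + k - 1 = u * n + k := by omega
    have hcase : ∀ v : Fin n, k ≤ v → v = ⟨k, hk⟩ ∨ k + 1 ≤ v := by
      intro v hv
      by_cases h : (v : ℕ) = k
      · exact Or.inl (Fin.ext h)
      · exact Or.inr (by omega)
    refine .seq_sub <| .seq_add <| .seq_sub <| .seq_load <| .ite (fun hne => ?_) (fun heq => ?_)
    · have hA : A u ⟨k, hk⟩ := by
        apply hadj.mp
        simpa [h13, hB₂.reg_one, h12₂, hidx] using hne
      refine .seq_load <| .seq_sub <| .ite (fun hlt => ?_) (fun hge => ?_)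
      · have hlt' : pr ⟨k, hk⟩ < s₂.reg 14 := by
          simp [h13, hB₂.reg_one, hpr] at hlt
          omega
        refine .seq_copy <| .copy ⟨by simp [h13, hB₂.reg_one],
          ⟨Or.inr ⟨⟨k, hk⟩, ?_, ?_, hA, by omega⟩, fun w hw hAw => ?_, by omega⟩⟩
        · simp [h13, hB₂.reg_one]
        · simp [h13, hB₂.reg_one, hpr]
        · have h14 : ∀ w, A u w → k ≤ w → pr ⟨k, hk⟩ ≤ pr w := by
            intro w hAw hw
            rcases hcase w hw with rfl | hw'
            · exact le_rfl
            · exact hlt'.le.trans (hmin w hw' hAw)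
          simpa [h13, hB₂.reg_one, hpr] using h14 w hAw hw
      · have hge' : s₂.reg 14 ≤ pr ⟨k, hk⟩ := by
          simp [h13, hB₂.reg_one, hpr] at hge
          omega
        refine .skip ⟨by simp [h13, hB₂.reg_one], by simpa using hbest, fun w hw hAw => ?_,
          by omega⟩
        rcases hcase w hw with rfl | hw'
        · simpa using hge'
        · simpa using hmin w hw' hAw
    · have hA : ¬ A u ⟨k, hk⟩ := by
        rw [← hadj, not_not]
        simpa [h13, hB₂.reg_one, h12₂, hidx] using heq
      refine .skip ⟨by simp [h13, hB₂.reg_one], by simpa using hbest, fun w hw hAw => ?_,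
        by omega⟩
      rcases hcase w hw with rfl | hw'
      · exact absurd hAw hA
      · simpa using hmin w hw' hAw
  · simp [hs₁, hB.reg_n]
  · exact ⟨Or.inl (by simp [hs₁, hB.reg_L]), fun w hw => absurd w.2 (by omega), le_rfl⟩
  · rintro s₂ _ ⟨hbest, hmin, _⟩
    exact ⟨hbest, fun w => hmin w (Nat.zero_le _)⟩

/-! ### Simulation of the auction by the program. -/

/-- The store holds a state of the auction. -/
def Holds (A : Fin m → Fin n → Prop) (u₀ : Fin m) (R : Finset (Fin m)) (pr : Fin n → ℕ)
    (own : Fin n → Option (Fin m)) (D : Finset (Fin m)) (cur : Option (Fin m)) (s : Store) :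
    Prop :=
  AuctionInv A (n + 2) u₀ R pr own D cur ∧ (∀ v : Fin n, s.arr 1 v = pr v) ∧
    (∀ v : Fin n, s.arr 2 v = code (n := n) (own v)) ∧ s.reg 9 = D.card

lemma within_bidLoop (hB : Base A s) {u₀ : Fin m} {R D : Finset (Fin m)} {pr : Fin n → ℕ}
    {own : Fin n → Option (Fin m)} {cur : Option (Fin m)} (hS : Holds A u₀ R pr own D cur s)
    (h12 : s.reg 12 = code (n := n) cur) :
    Within (.loop 12 bidBody) s ((n * (n + 2) + 1) * (n * 11 + 11) + 1) fun s' =>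
      ∃ pr' own' D', Holds A u₀ R pr' own' D' none s' := by
  -- The measure is constrained only while a vertex is active, so the last round, which may leave
  -- all prices unchanged, is covered too.
  refine (Within.loop (B := n * 11 + 10) (I := fun k s' => ∃ pr' own' D' cur',
    Holds A u₀ R pr' own' D' cur' s' ∧ s'.reg 12 = code (n := n) cur' ∧
    (cur' ≠ none → ∑ v, (n + 2 - pr' v) < k)) (k := n * (n + 2) + 1) ?_ ?_).mono le_rfl ?_
  · rintro k s₁ ⟨pr', own', D', cur', ⟨hinv, h1, h2, h9⟩, hcur, hk⟩ hF hne
    have hB₁ := hB.frame hF rfl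
    cases cur' with
    | none => exact absurd hcur hne
    | some u =>
      rw [code_some] at hcur
      replace hk := hk (by simp)
      refine ⟨∑ v, (n + 2 - pr' v), hk, ?_⟩
      refine Within.seq (B := n * 11 + 3) (B' := 7)
        ((within_scan hB₁ hcur h1).mono le_rfl ?_)
      rintro s₂ - ⟨hbest, hmin⟩ hF₂
      have hB₂ := hB₁.frame hF₂ rfl
      have h1₂ : ∀ v : Fin n, s₂.arr 1 v = pr' v := by rwa [hF₂.arr 1 rfl]
      have h2₂ : ∀ v : Fin n, s₂.arr 2 v = code (n := n) (own' v) := by rwa [hF₂.arr 2 rfl]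
      have h9₂ : s₂.reg 9 = D'.card := by rwa [hF₂.reg 9 rfl]
      have h12₂ : s₂.reg 12 = u * n + 1 := by rwa [hF₂.reg 12 rfl]
      refine .seq_sub <| .ite (fun hlt => ?_) (fun hge => ?_)
      · simp [hB₂.reg_L] at hlt
        rcases hbest with h | ⟨v, h15, h14, hA, hv⟩
        · omega
        refine .seq_load <| .seq_store <| .seq_add <| .seq_store <| .copy
          ⟨_, _, _, _, ⟨hinv.bid hA hv (h14 ▸ hmin), ?_, ?_, ?_⟩, ?_, fun _ => ?_⟩
        · intro w
          by_cases hw : w = v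
          · subst hw
            simp [h15, h14, hB₂.reg_one]
          · have hw' : (w : ℕ) ≠ v := fun h => hw (Fin.ext h)
            simp [h15, hw, hw', h1₂]
        · intro w
          by_cases hw : w = v
          · subst hw
            simp [h15, h12₂, code_some]
          · have hw' : (w : ℕ) ≠ v := fun h => hw (Fin.ext h)
            simp [h15, hw, hw', h2₂]
        · simpa using h9₂
        · simp [h15, h2₂]
        · exact AuctionInv.sum_sub_update_lt hv
      · replace hge : n + 2 ≤ s₂.reg 14 := by
          simp only [Store.setReg_reg, if_true, hB₂.reg_L] at hge
          omega
        refine .seq_add <| .const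
          ⟨_, _, _, none, ⟨hinv.giveUp fun v hv => hge.trans (hmin v hv), ?_, ?_, ?_⟩, ?_, ?_⟩
        · simpa using h1₂
        · simpa using h2₂
        · rw [Finset.card_insert_of_notMem (hinv.cur_notMem u rfl)]
          simp [h9₂, hB₂.reg_one]
        · simp [code_none]
        · simp
  -- Initially the measure is at most $n(n+2)$; the extra unit makes the inequality strict.
  · refine ⟨pr, own, D, cur, hS, h12, fun _ => Nat.lt_succ_of_le ?_⟩
    refine (Finset.sum_le_card_nsmul _ _ (n + 2) fun v _ => Nat.sub_le _ _).trans ?_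
    simp
  · rintro s₁ _ ⟨h0, _, pr', own', D', cur', hS', hcur, _⟩
    cases cur' with
    | none => exact ⟨pr', own', D', hS'⟩
    | some u => rw [h0, code_some] at hcur; omega

/-- A bound for the number of steps of one auction. -/
def auctionCost (m n : ℕ) : ℕ := m * ((n * (n + 2) + 1) * (n * 11 + 11) + 5) + 3

lemma within_auction (hB : Base A s) {u₀ : Fin m} {pr : Fin n → ℕ}
    (hS : Holds A u₀ ∅ pr (fun _ => none) ∅ none s) :
    Within auction s (auctionCost m n) fun s' =>
      ∃ pr' own' D', Holds A u₀ Finset.univ pr' own' D' none s' := by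
  refine .seq_copy <| .seq_copy ?_
  set s₁ := (s.setReg 10 _).setReg 11 _ with hs₁
  have hB₁ : Base A s₁ := by
    constructor <;> simp [hs₁, hB.reg_m, hB.reg_n, hB.reg_L, hB.reg_one, hB.reg_size]
    simpa using hB.adj
  -- The vertices enter in decreasing order, so the row pointer moves down by $n$ each time.
  refine (Within.countdown (B := (n * (n + 2) + 1) * (n * 11 + 11) + 4) (I := fun k s' =>
    s'.reg 11 = k * n ∧ k ≤ m ∧ ∃ pr' own' D',
      Holds A u₀ ({u | k ≤ u} : Finset (Fin m)) pr' own' D' none s') (k := m)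
      ?_ ?_ ?_).mono le_rfl ?_
  · rintro k s₂ ⟨h11, hk, pr', own', D', hinv, h1, h2, h9⟩ h10 hF
    have hB₂ := hB₁.frame hF rfl
    have hR : insert (⟨k, hk⟩ : Fin m) ({u | k + 1 ≤ u} : Finset (Fin m)) =
        ({u | k ≤ u} : Finset (Fin m)) := by
      ext u
      simp only [Finset.mem_insert, Finset.mem_filter, Finset.mem_univ, true_and, Fin.ext_iff]
      omega
    have hinv' := hinv.enter (u := ⟨k, hk⟩) (by simp)
    rw [hR] at hinv'
    have hsub : (k + 1) * n - n = k * n := by rw [Nat.add_mul, Nat.one_mul, Nat.add_sub_cancel]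
    refine .seq_sub <| .seq_sub <| .seq_add ?_
    set s₃ := ((s₂.setReg 10 _).setReg 11 _).setReg 12 _ with hs₃
    have hB₃ : Base A s₃ := by
      constructor <;> simp [hs₃, hB₂.reg_m, hB₂.reg_n, hB₂.reg_L, hB₂.reg_one, hB₂.reg_size]
      simpa using hB₂.adj
    refine (within_bidLoop hB₃ (cur := some ⟨k, hk⟩)
      ⟨hinv', by simpa [hs₃] using h1, by simpa [hs₃] using h2, by simpa [hs₃] using h9⟩
      ?_).mono le_rfl ?_
    · simp [hs₃, code_some, h11, hB₂.reg_n, hB₂.reg_one, hsub]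
    · rintro s₄ hF₄ hS₄
      refine ⟨?_, ?_, by omega, hS₄⟩
      · rw [hF₄.reg 10 rfl]; simp [hs₃, h10, hB₂.reg_one]
      · rw [hF₄.reg 11 rfl]; simp [hs₃, h11, hB₂.reg_n, hsub]
  · simp [hs₁, hB.reg_m]
  · refine ⟨by simp [hs₁, hB.reg_size], le_rfl, pr, fun _ => none, ∅, ?_⟩
    have hR : ({u | m ≤ u} : Finset (Fin m)) = ∅ := by
      ext u
      have := u.2
      simp only [Finset.mem_filter, Finset.mem_univ, true_and, Finset.notMem_empty, iff_false]
      omega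
    rw [hR]
    simpa [Holds, hs₁] using hS
  · rintro s₂ _ ⟨_, _, pr', own', D', hS'⟩
    refine ⟨pr', own', D', ?_⟩
    convert hS'
    simp

/-- A bound for the number of steps of one round. -/
def valueCost (m n : ℕ) : ℕ := n * 10 + 4 + (auctionCost m n + 6) + 1 + 1

lemma within_values (hB : Base A s) (h4 : s.reg 4 = n) (h5 : s.reg 5 = 0) (h6 : s.reg 6 = m)
    (h7 : s.reg 7 = m * n) :
    Within (.loop 6 valueBody) s (m * (valueCost m n + 1) + 1) fun s' =>
      ((s'.reg 4 : ℤ) - s'.reg 5 = n ∨ ∃ S : Finset (Fin m), S.Nonempty ∧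
        (s'.reg 4 : ℤ) - s'.reg 5 = surplus A S) ∧
      ∀ S : Finset (Fin m), S.Nonempty → (s'.reg 4 : ℤ) - s'.reg 5 ≤ surplus A S := by
  classical
  -- After the rounds for all $u_0\ge k$, the stored value bounds the surplus of every set that
  -- meets $\{u\mid u\ge k\}$. The alternative $n$ is the starting value.
  refine (Within.countdown (I := fun k s' => s'.reg 7 = k * n ∧ k ≤ m ∧
    ((s'.reg 4 : ℤ) - s'.reg 5 = n ∨ ∃ S : Finset (Fin m), S.Nonempty ∧
      (s'.reg 4 : ℤ) - s'.reg 5 = surplus A S) ∧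
    ∀ u : Fin m, k ≤ u → ∀ S : Finset (Fin m), u ∈ S →
      (s'.reg 4 : ℤ) - s'.reg 5 ≤ surplus A S) (k := m) ?_ h6 ?_).mono le_rfl ?_
  · rintro k s₁ ⟨h7, hk, hatt, hmin⟩ h6 hF
    have hB₁ := hB.frame hF rfl
    have hsub : (k + 1) * n - n = k * n := by rw [Nat.add_mul, Nat.one_mul, Nat.add_sub_cancel]
    refine .seq_sub <| .seq_sub ?_
    set s₂ := (s₁.setReg 6 _).setReg 7 _ with hs₂
    have hB₂ : Base A s₂ := by
      constructor <;> simp [hs₂, hB₁.reg_m, hB₁.reg_n, hB₁.reg_L, hB₁.reg_one, hB₁.reg_size]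
      simpa using hB₁.adj
    have h7₂ : s₂.reg 7 = (⟨k, hk⟩ : Fin m) * n := by simp [hs₂, h7, hB₁.reg_n, hsub]
    refine .seq ((within_reset hB₂ h7₂).mono le_rfl ?_)
    rintro s₃ - ⟨hp, ho, h8, h9⟩ hF₃
    have hB₃ := hB₂.frame hF₃ rfl
    refine .seq ((within_auction hB₃ (u₀ := ⟨k, hk⟩) (pr := fun v => s₃.arr 1 v)
      ⟨AuctionInv.init (fun v hv => by rw [hp, if_pos hv]) (fun v hv => by rw [hp, if_neg hv]),
        fun _ => rfl, ho, by simpa using h9⟩).mono le_rfl ?_)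
    rintro s₄ - ⟨pr, own, D, hinv, -, -, h9₄⟩ hF₄
    have hB₄ := hB₃.frame hF₄ rfl
    have hval := hinv.isLeast_surplus (by simp)
    have h8₄ : s₄.reg 8 = (nbr A {⟨k, hk⟩}).card := by rw [hF₄.reg 8 rfl, h8]
    rw [← h8₄, ← h9₄] at hval
    have h4₄ : s₄.reg 4 = s₁.reg 4 := by
      rw [hF₄.reg 4 rfl, hF₃.reg 4 rfl]; simp [hs₂]
    have h5₄ : s₄.reg 5 = s₁.reg 5 := by
      rw [hF₄.reg 5 rfl, hF₃.reg 5 rfl]; simp [hs₂]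
    have h6₄ : s₄.reg 6 = k := by
      rw [hF₄.reg 6 rfl, hF₃.reg 6 rfl]; simp [hs₂, h6, hB₁.reg_one]
    have h7₄ : s₄.reg 7 = k * n := by
      rw [hF₄.reg 7 rfl, hF₃.reg 7 rfl, h7₂]
    have hcase : ∀ v : Fin m, k ≤ v → v = ⟨k, hk⟩ ∨ k + 1 ≤ v := by
      intro v hv
      by_cases h : (v : ℕ) = k
      · exact Or.inl (Fin.ext h)
      · exact Or.inr (by omega)
    refine .seq_add <| .seq_add <| .seq_sub <| .ite (fun hlt => ?_) (fun hge => ?_)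
    · simp [h4₄, h5₄] at hlt
      obtain ⟨S, hS, hSv⟩ := hval.1
      refine .seq_copy <| .copy ⟨by simpa using h6₄, by simpa using h7₄, by omega,
        Or.inr ⟨S, ⟨_, hS⟩, by simpa using hSv.symm⟩, fun u hu T hT => ?_⟩
      simp only [Store.setReg_reg]
      norm_num
      rcases hcase u hu with rfl | hu'
      · have := hval.2 ⟨T, hT, rfl⟩
        omega
      · have := hmin u hu' T hT
        omega
    · simp [h4₄, h5₄] at hge
      refine .skip ⟨by simpa using h6₄, by simpa using h7₄, by omega,
        by simpa [h4₄, h5₄] using hatt, fun u hu T hT => ?_⟩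
      simp only [Store.setReg_reg]
      norm_num [h4₄, h5₄]
      rcases hcase u hu with rfl | hu'
      · have := hval.2 ⟨T, hT, rfl⟩
        omega
      · have := hmin u hu' T hT
        omega
  · exact ⟨h7, le_rfl, Or.inl (by simp [h4, h5]), fun u hu => absurd u.2 (by omega)⟩
  · rintro s₁ _ ⟨_, _, hatt, hmin⟩
    exact ⟨hatt, fun S ⟨u, hu⟩ => hmin u (Nat.zero_le _) S hu⟩

lemma within_sizeLoop (h1 : s.reg 1 = n) (h3 : s.reg 3 = 1) (h6 : s.reg 6 = m)
    (h18 : s.reg 18 = 0) :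
    Within sizeLoop s (m * 3 + 1) fun s' => s'.reg 18 = m * n := by
  refine (Within.countdown (B := 2) (I := fun k s' => s'.reg 18 + k * n = m * n) (k := m) ?_ h6
    (by simp [h18])).mono le_rfl fun s' _ h => by simpa using h
  rintro k s₁ h hk hF
  have h1₁ : s₁.reg 1 = n := by rw [hF.reg 1 rfl, h1]
  have h3₁ : s₁.reg 3 = 1 := by rw [hF.reg 3 rfl, h3]
  refine .seq_sub <| .add ⟨by simp [hk, h3₁], ?_⟩
  rw [Nat.add_mul] at h
  simp [h1₁]
  omega

/-! ### Reading the input, and the cost of the whole program. -/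

open Classical in
lemma input_adj (G : SimpleGraph (Fin m ⊕ Fin n)) (i : Fin m) (j : Fin n) :
    (input G).arr 0 (i * n + j) ≠ 0 ↔ biadj G i j := by
  simp only [input, biadj, true_and, ne_eq, ite_eq_right_iff, one_ne_zero, imp_false, not_not]
  constructor
  -- Reduction modulo $n$ recovers the column from the index; cancelling $n>0$ then recovers the
  -- row.
  · rintro ⟨i', j', h, hadj⟩
    have hj : (j : ℕ) = j' := by
      have := congrArg (· % n) h
      simpa [Nat.mul_add_mod_of_lt, Nat.mul_comm, Nat.mul_add_mod, Nat.mod_eq_of_lt] using this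
    have hi : (i : ℕ) = i' := by
      have hn : 0 < n := j.pos
      exact Nat.eq_of_mul_eq_mul_right hn (by omega)
    rwa [Fin.ext hi, Fin.ext hj]
  · exact fun h => ⟨i, j, rfl, h⟩

/-- A bound for the number of steps of the program. -/
def blockerCost (m n : ℕ) : ℕ :=
  m * 3 + 1 + (m * (valueCost m n + 1) + 1 + 2 + 1 + 1 + 1 + 1) + 1 + 1 + 1 + 1 + 1

lemma within_blockerProg (hm : 1 ≤ m) (G : SimpleGraph (Fin m ⊕ Fin n)) :
    Within blockerProg (input G) (blockerCost m n) fun s' =>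
      ∃ z : ℤ, Outputs s' z ∧ IsLeast (surplus (biadj G) '' {S | S.Nonempty}) z := by
  refine .seq_const <| .seq_add <| .seq_add <| .seq_const <| .seq_copy ?_
  set s₁ := (((((input G).setReg 3 1).setReg 2 _).setReg 2 _).setReg 18 0).setReg 6 _ with hs₁
  refine .seq ((within_sizeLoop (m := m) (n := n) (by simp [hs₁, input]) (by simp [hs₁])
    (by simp [hs₁, input]) (by simp [hs₁])).mono le_rfl ?_)
  rintro s₂ - h18 hF
  have hB₂ : Base (biadj G) s₂ := by
    refine ⟨?_, ?_, ?_, ?_, h18, ?_⟩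
    · rw [hF.reg 0 rfl]; simp [hs₁, input]
    · rw [hF.reg 1 rfl]; simp [hs₁, input]
    · rw [hF.reg 2 rfl]; simp [hs₁, input]
    · rw [hF.reg 3 rfl]; simp [hs₁]
    · rw [hF.arr 0 rfl]; exact input_adj G
  refine .seq_copy <| .seq_const <| .seq_copy <| .seq_copy ?_
  set s₃ := (((s₂.setReg 4 _).setReg 5 0).setReg 6 _).setReg 7 _ with hs₃
  have hB₃ : Base (biadj G) s₃ := by
    constructor <;> simp [hs₃, hB₂.reg_m, hB₂.reg_n, hB₂.reg_L, hB₂.reg_one, hB₂.reg_size]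
    simpa using hB₂.adj
  refine Within.seq (B := m * (valueCost m n + 1) + 1) (B' := 2) ((within_values hB₃ (by simp [hs₃, hB₂.reg_n]) (by simp [hs₃])
    (by simp [hs₃, hB₂.reg_m]) (by simp [hs₃, hB₂.reg_size])).mono le_rfl ?_)
  rintro s₄ - ⟨hatt, hmin⟩ -
  refine .seq_sub <| .sub ⟨(s₄.reg 4 : ℤ) - s₄.reg 5, ⟨?_, ?_⟩, ?_, ?_⟩
  · simp
  · simp
  -- The starting value $n$ cannot survive: a singleton has surplus at most $n-1$, and $U$ is
  -- nonempty.
  · rcases hatt with h | h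
    · have h1 := hmin {⟨0, hm⟩} (Finset.singleton_nonempty _)
      have h2 := Finset.card_le_univ (nbr (biadj G) {(⟨0, hm⟩ : Fin m)})
      simp only [surplus, Finset.card_singleton, Fintype.card_fin] at h1 h2
      omega
    · obtain ⟨S, hS, h⟩ := h
      exact ⟨S, hS, h.symm⟩
  · rintro _ ⟨S, hS, rfl⟩
    exact hmin S hS

lemma exists_polynomial_blockerCost_le :
    ∃ p : Polynomial ℕ, ∀ m n : ℕ, blockerCost m n ≤ p.eval (m + n) := by
  let x : Polynomial ℕ := Polynomial.X
  let a := x * ((x * (x + 2) + 1) * (x * 11 + 11) + 5) + 3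
  let v := x * 10 + 4 + (a + 6) + 1 + 1
  refine ⟨x * 3 + 1 + (x * (v + 1) + 1 + 2 + 1 + 1 + 1 + 1) + 1 + 1 + 1 + 1 + 1, fun m n => ?_⟩
  have hm : m ≤ m + n := Nat.le_add_right m n
  have hn : n ≤ m + n := Nat.le_add_left n m
  -- The cost is monotone in both sizes, so each may be replaced by $m+n$.
  calc blockerCost m n ≤ blockerCost (m + n) (m + n) := by
        simp only [blockerCost, valueCost, auctionCost]
        gcongr
    _ = _ := by simp [x, a, v, blockerCost, valueCost, auctionCost]

end Correctness

end BCMBP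

theorem mainTheorem2 :
    (∀ (U V : Type*) [Fintype U] [Fintype V] [DecidableEq U] [DecidableEq V]
        (G : SimpleGraph (U ⊕ V)), Nonempty U → BCMBP.Bipartite G →
      (∀ u : U,
        (BCMBP.ipMatrix G u).IsTotallyUnimodular ∧
        (∀ x ∈ (BCMBP.lpFeasible G u).extremePoints ℝ, ∀ w, x w = 0 ∨ x w = 1) ∧
        ∃ z : ℤ, BCMBP.IsIPValue G u z ∧ BCMBP.IsLPValue G u z) ∧
      ∃ z : ℤ, IsLeast {y : ℤ | ∃ u : U, BCMBP.IsIPValue G u y} z ∧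
        ∀ κ : ℕ, BCMBP.IsKappa G κ ↔ (κ : ℤ) = z) ∧
    ∃ P : BCMBP.Prog, BCMBP.SolvesInPolyTime P (fun m _ G z =>
      IsLeast {y : ℤ | ∃ u : Fin m, BCMBP.IsIPValue G u y} z ∧
        ∀ κ : ℕ, BCMBP.IsKappa G κ ↔ (κ : ℤ) = z) := by
  open BCMBP in
  refine ⟨fun U V _ _ _ _ G hU hG => ⟨fun u => ⟨ipMatrix_isTotallyUnimodular G u,
    fun x hx => eq_zero_or_one_of_mem_extremePoints hx, ?_⟩, ?_⟩, blockerProg, ?_⟩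
  · obtain ⟨z, hz⟩ := exists_isIPValue G u
    exact ⟨z, hz, hz.isLPValue⟩
  · obtain ⟨S, hS, hmin⟩ := Set.exists_min_image {S : Finset U | S.Nonempty} (surplus (biadj G))
      (Set.toFinite _) ⟨Finset.univ, Finset.univ_nonempty⟩
    have hz : IsLeast (surplus (biadj G) '' {S | S.Nonempty}) (surplus (biadj G) S) := by
      refine ⟨⟨S, hS, rfl⟩, ?_⟩
      rintro _ ⟨T, hT, rfl⟩
      exact hmin T hT
    exact ⟨_, isLeast_isIPValue_iff.mpr hz, isKappa_iff hG hz⟩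
  · obtain ⟨p, hp⟩ := exists_polynomial_blockerCost_le
    refine ⟨p, fun m n G hm hG => ?_⟩
    obtain ⟨t, s, hr, ht, z, hout, hz⟩ := within_blockerProg hm G
    have : Nonempty (Fin m) := ⟨⟨0, hm⟩⟩
    exact ⟨t, s, z, hr, ht.trans (hp m n), hout, isLeast_isIPValue_iff.mpr hz, isKappa_iff hG hz⟩
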